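/- **Setting.** A planar linear inequality is a formal expression $e\equiv ax+by\le c$ with $a,b,c\in\mathbb R$ and $(a,b)\ne(0,0)$; $\mathrm{Lin}$ is the set of all of them. For a set $E$ of inequalities, $[\![E]\!]\subseteq\mathbb R^2$ is the set of points satisfying all of them; $E$ is satisfiable if $[\![E]\!]\neq\emptyset$, and non-redundant if $[\![E\setminus\{e\}]\!]\ne[\![E]\!]$ for all $e\in E$. A point saturates $e$ if it lies on the line $ax+by=c$. Let $\theta(e)\in[0,2\pi)$ be the angle with $\cos\theta(e)=a/\sqrt{a^2+b^2}$, $\sin\theta(e)=b/\sqrt{a^2+b^2}$, and $\angle(e,e')=(\theta(e')-\theta(e))\bmod 2\pi$. For finite sets, $\mathrm{conv}(P)$ is the convex hull and $\mathrm{cone}(R)=\{\sum_{r\in R}\lambda_r r\mid\lambda_r\ge0\}$, so $\mathrm{cone}(\emptyset)=\{0\}$. **$\mathit{extreme}(E)$** returns finite sets $\langle V,R\rangle$ as follows. Sort $E$ as $e_0,\dots,e_{n-1}$ with $\theta(e_0)<\dots<\theta(e_{n-1})$ (indices mod $n$). Start with $V=R=\emptyset$. If $n=1$ and $e_0\equiv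 ax+by\le c$, add $\langle -a,-b\rangle/\sqrt{a^2+b^2}$ to $R$. For every $i$, with $e_i\equiv ax+by\le c$, let $d_{pre}$ be the condition $\angle(e_{i-1},e_i)\ge\pi\vee n=1$ and $d_{post}$ the condition $\angle(e_i,e_{i+1})\ge\pi\vee n=1$. If $d_{pre}$, add $\langle b,-a\rangle/\sqrt{a^2+b^2}$ to $R$. If $d_{post}$, add $\langle -b,a\rangle/\sqrt{a^2+b^2}$ to $R$; otherwise add to $V$ the intersection of the boundary lines of $e_i$ and $e_{i+1}$. If $d_{pre}\wedge d_{post}$, add to $V$ an arbitrary point saturating $e_i$. **$\mathit{hull}(E_1,E_2)$** returns $\emptyset$ if $E_1=\emptyset$ or $E_2=\emptyset$. Otherwise let $\langle P_i,R_i\rangle=\mathit{extreme}(E_i)$, $P=P_1\cup P_2$, $R=R_1\cup R_2$, $s=1+\max\{|x|,|y|\mid\langle x,y\rangle\in P\}$ and $Q=P\cup\{p+2\sqrt2\,s\,r\mid p\in P,\ r\in R\}$. A point $\langle x,y\rangle$ is in the box if $|x|<s$ and $|y|<s$. If $Q=\{\langle x_1,y_1\rangle\}$, return $\{x\le x_1,\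 y\le y_1,\ -x\le -x_1,\ -y\le -y_1\}$. Otherwise let $q_p$ be the arithmetic mean of $Q$, and let $\mathit{connect}(p_1,p_2)$, for $p_1=\langle x_1,y_1\rangle$ and $p_2=\langle x_2,y_2\rangle$, be the inequality $(y_2-y_1)x+(x_1-x_2)y\le(y_2-y_1)x_1+(x_1-x_2)y_1$. Sort $Q$ as $q_0,\dots,q_{n-1}$ so that $\theta(\mathit{connect}(q_p,q_i))$ is non-decreasing (ties are broken arbitrarily; if $q_p\in Q$, it may occupy any position). The scan step yields the indices $k_0<\dots<k_{m-1}$ of those $q_j$ that are vertices of $\mathrm{conv}(Q)$. Starting from $E_{\mathrm{res}}=\emptyset$, for every $i\in\{0,\dots,m-1\}$ let $p_1=\langle x_1,y_1\rangle=q_{k_i}$, $p_2=\langle x_2,y_2\rangle=q_{k_{(i+1)\bmod m}}$, $e=\mathit{connect}(p_1,p_2)$, and do the following. - If $m=2$ and $p_1$ is in the box, add $\mathrm{sgn}(x_1-x_2)\,x\le\mathrm{sgn}(x_1-x_2)\,x_1$ when $y_1=y_2$, and $\mathrm{sgn}(y_1-y_2)\,y\le\mathrm{sgn}(y_1-y_2)\,y_1$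 when $y_1\ne y_2$. - Add $e$ if $p_1$ or $p_2$ is in the box, or $m=2$, or some $q_j$ with $j$ cyclically (mod $n$) strictly between $k_i$ and $k_{(i+1)\bmod m}$ saturates $e$ and is in the box. Return $E_{\mathrm{res}}$. **Theorem.** Let $E_1,E_2\subset\mathrm{Lin}$ be non-empty, finite, satisfiable and non-redundant. Then $\mathit{hull}(E_1,E_2)$ returns a result, and for every possible result $E_{\mathrm{res}}$ (whatever arbitrary choices are made in the run), with $\langle P_i,R_i\rangle=\mathit{extreme}(E_i)$ the intermediate results of that run: 1. $E_{\mathrm{res}}$ is a finite, non-redundant subset of $\mathrm{Lin}$; 2. $[\![E_1]\!]\cup[\![E_2]\!]\subseteq[\![E_{\mathrm{res}}]\!]$; 3. for every set $E$ of inequalities $ax+by\le c$ with $a,b,c\in\mathbb R$ (here $a=b=0$ is allowed; in particular for every H-polyhedron), if $[\![E_1]\!]\cup[\![E_2]\!]\subseteq[\![E]\!]$ then $[\![E_{\mathrm{res}}]\!]\subseteq[\![E]\!]$; 4. $[\![E_{\mathrm{res}}]\!]=\mathrm{conv}(P_1\cup P_2)+\mathrm{cone}(R_1\cup R_2)$.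 -/

import Mathlib

open scoped Pointwise

namespace PlanarHull

noncomputable section

/-- Points (and direction vectors) of the plane. -/
abbrev Pt : Type := ℝ × ℝ

/-- The formal planar inequality `a x + b y ≤ c`. -/
@[ext]
structure Ineq where
  a : ℝ
  b : ℝ
  c : ℝ

/-- The linear inequalities proper: those with `a ≠ 0` or `b ≠ 0`. -/
def Lin : Set Ineq := {e | e.a ≠ 0 ∨ e.b ≠ 0}

/-- The point `p` satisfies `e`. -/
def Holds (p : Pt) (e : Ineq) : Prop := e.a * p.1 + e.b * p.2 ≤ e.c

/-- The point `p` lies on the boundary line of `e`. -/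
def Saturates (p : Pt) (e : Ineq) : Prop := e.a * p.1 + e.b * p.2 = e.c

/-- The polyhedron `⟦E⟧` described by a set of inequalities. -/
def sol (E : Set Ineq) : Set Pt := {p | ∀ e ∈ E, Holds p e}

def Satisfiable (E : Set Ineq) : Prop := (sol E).Nonempty

def NonRedundant (E : Set Ineq) : Prop := ∀ e ∈ E, sol (E \ {e}) ≠ sol E

/-- The cone spanned by a finite set of vectors; in particular `cone ∅ = {0}`. -/
def cone (R : Finset Pt) : Set Pt :=
  {x | ∃ w : Pt → ℝ, (∀ r ∈ R, 0 ≤ w r) ∧ x = ∑ r ∈ R, w r • r}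

/-- The vertices of a convex set. -/
def vert (S : Set Pt) : Set Pt := {p ∈ S | p ∉ convexHull ℝ (S \ {p})}

/-- Orientation of an inequality: the angle in `[0, 2π)` of the vector `(a, b)`. -/
def theta (e : Ineq) : ℝ := toIcoMod Real.two_pi_pos 0 (Complex.arg ⟨e.a, e.b⟩)

/-- Counter-clockwise angle from `e₁` to `e₂`, i.e. `(θ e₂ - θ e₁) mod 2π`. -/
def ang (e₁ e₂ : Ineq) : ℝ := toIcoMod Real.two_pi_pos 0 (theta e₂ - theta e₁)

/-- `theta` is the angle that is meant. -/
theorem theta_spec (e : Ineq) (he : e ∈ Lin) :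
    theta e ∈ Set.Ico 0 (2 * Real.pi) ∧
      Real.cos (theta e) = e.a / √(e.a ^ 2 + e.b ^ 2) ∧
      Real.sin (theta e) = e.b / √(e.a ^ 2 + e.b ^ 2) := by
  have hz : (⟨e.a, e.b⟩ : ℂ) ≠ 0 := by
    intro h
    have h1 := congrArg Complex.re h
    have h2 := congrArg Complex.im h
    simp at h1 h2
    rcases he with h | h
    · exact h h1
    · exact h h2
  have hn : ‖(⟨e.a, e.b⟩ : ℂ)‖ = √(e.a ^ 2 + e.b ^ 2) := by
    rw [Complex.norm_def, Complex.normSq_mk]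
    congr 1
    ring
  refine ⟨by simpa [theta] using toIcoMod_mem_Ico Real.two_pi_pos 0 (Complex.arg ⟨e.a, e.b⟩), ?_, ?_⟩
  · rw [theta, toIcoMod, zsmul_eq_mul, Real.cos_sub_int_mul_two_pi, Complex.cos_arg hz, hn]
  · rw [theta, toIcoMod, zsmul_eq_mul, Real.sin_sub_int_mul_two_pi, Complex.sin_arg, hn]

/-- The index `(i + t) mod n`. -/
def cyc {n : ℕ} (i : Fin n) (t : ℕ) : Fin n := ⟨(i.val + t) % n, Nat.mod_lt _ i.pos⟩

/-- The intersection points of the two boundary lines. -/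
def intersect (e₁ e₂ : Ineq) : Set Pt := {p | Saturates p e₁ ∧ Saturates p e₂}

/-- The unit vector in the direction of `(u, v)`. -/
def unit (u v : ℝ) : Pt := (u / √(u ^ 2 + v ^ 2), v / √(u ^ 2 + v ^ 2))

/-- Flag `d_pre` of iteration `i`: degenerate intersection with the preceding inequality
`e_{(i-1) mod n}`. -/
def DPre {n : ℕ} (e : Fin n → Ineq) (i : Fin n) : Prop :=
  Real.pi ≤ ang (e (cyc i (n - 1))) (e i) ∨ n = 1

/-- Flag `d_post` of iteration `i`: degenerate intersection with the following inequality
`e_{(i+1) mod n}`. -/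
def DPost {n : ℕ} (e : Fin n → Ineq) (i : Fin n) : Prop :=
  Real.pi ≤ ang (e i) (e (cyc i 1)) ∨ n = 1

/-- `⟨V, R⟩` is a possible result of `extreme(E)`.
Here `e` is the set `E` sorted by orientation and `v i` is the freely chosen boundary point of
`e i`, which is used only if both flags are set. -/
def IsExtreme (E : Set Ineq) (V R : Finset Pt) : Prop :=
  ∃ (n : ℕ) (e : Fin n → Ineq) (v : Fin n → Pt),
    Set.range e = E ∧
    StrictMono (fun i => theta (e i)) ∧
    (∀ i, Saturates (v i) (e i)) ∧
    (V : Set Pt) = {p | ∃ i,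
      (¬ DPost e i ∧ p ∈ intersect (e i) (e (cyc i 1))) ∨
      (DPre e i ∧ DPost e i ∧ p = v i)} ∧
    (R : Set Pt) = {r | ∃ i,
      (n = 1 ∧ r = unit (-(e i).a) (-(e i).b)) ∨
      (DPre e i ∧ r = unit (e i).b (-(e i).a)) ∨
      (DPost e i ∧ r = unit (-(e i).b) (e i).a)}

/-- The inequality with `p₁`, `p₂` on its boundary whose feasible side is to the left of the
direction from `p₁` to `p₂`. -/
def connect (p₁ p₂ : Pt) : Ineq :=
  ⟨p₂.2 - p₁.2, p₁.1 - p₂.1, (p₂.2 - p₁.2) * p₁.1 + (p₁.1 - p₂.1) * p₁.2⟩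

def InBox (s : ℝ) (p : Pt) : Prop := |p.1| < s ∧ |p.2| < s

/-- The point set `Q`: all points of `P`, and their translates along the rays by the length of
the diagonal of the box. -/
def boxedPoints (P R : Finset Pt) (s : ℝ) : Finset Pt :=
  P ∪ (P ×ˢ R).image fun pr =>
    (pr.1.1 + 2 * √2 * s * pr.2.1, pr.1.2 + 2 * √2 * s * pr.2.2)

/-- The centre of gravity of a finite point set (the pivot point). -/
def centroid (Q : Finset Pt) : Pt :=
  ((∑ q ∈ Q, q.1) / (Q.card : ℝ), (∑ q ∈ Q, q.2) / (Q.card : ℝ))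

/-- `q 0, …, q (n-1)` lists `Q` without repetition, counter-clockwise around the pivot. Ties are
ordered arbitrarily; the pivot, if it is itself a point of `Q`, has no orientation and may be
listed anywhere. -/
def IsSorted {n : ℕ} (pivot : Pt) (Q : Finset Pt) (q : Fin n → Pt) : Prop :=
  Function.Injective q ∧ Set.range q = (Q : Set Pt) ∧
  ∀ i j, i < j → q i ≠ pivot → q j ≠ pivot →
    theta (connect pivot (q i)) ≤ theta (connect pivot (q j))

/-- `k 0 < … < k (m-1)` are the indices kept by the convex hull scan of the sorted point sequence
`q`, namely those of the vertices of the convex hull. -/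
def IsScan {n m : ℕ} (q : Fin n → Pt) (k : Fin m → Fin n) : Prop :=
  StrictMono k ∧ Set.range k = {i | q i ∈ vert (convexHull ℝ (Set.range q))}

/-- Value of the flag `add` at the end of iteration `i` of the round trip around the hull. In the
last alternative, the inner loop, which runs through `j = k_i + 1, k_i + 2, …` (modulo `n`) and
stops before `k_{i+1}`, finds a point `q_j` in the box on the boundary of the edge inequality. -/
def Add {n m : ℕ} (s : ℝ) (q : Fin n → Pt) (k : Fin m → Fin n) (i : Fin m) : Prop :=
  InBox s (q (k i)) ∨ InBox s (q (k (cyc i 1))) ∨ m = 2 ∨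
  ∃ t : ℕ, 1 ≤ t ∧ (∀ u, 1 ≤ u → u ≤ t → cyc (k i) u ≠ k (cyc i 1)) ∧
    Saturates (q (cyc (k i) t)) (connect (q (k i)) (q (k (cyc i 1)))) ∧
    InBox s (q (cyc (k i) t))

/-- The additional inequality that cuts off a line at its end point `p₁`, where `p₂` is another
point of the line. -/
def cap (p₁ p₂ : Pt) : Ineq :=
  if p₁.2 = p₂.2 then
    ⟨Real.sign (p₁.1 - p₂.1), 0, Real.sign (p₁.1 - p₂.1) * p₁.1⟩
  else
    ⟨0, Real.sign (p₁.2 - p₂.2), Real.sign (p₁.2 - p₂.2) * p₁.2⟩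

/-- The inequalities emitted during the round trip around the hull. -/
def roundTrip {n m : ℕ} (s : ℝ) (q : Fin n → Pt) (k : Fin m → Fin n) : Set Ineq :=
  {e | ∃ i : Fin m,
    (m = 2 ∧ InBox s (q (k i)) ∧ e = cap (q (k i)) (q (k (cyc i 1)))) ∨
    (Add s q k i ∧ e = connect (q (k i)) (q (k (cyc i 1))))}

/-- The four inequalities that describe a single point. -/
def pointIneqs (p : Pt) : Set Ineq :=
  {⟨1, 0, p.1⟩, ⟨0, 1, p.2⟩, ⟨-1, 0, -p.1⟩, ⟨0, -1, -p.2⟩}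

/-- `Eres` is a possible result of the reconstruction phase on the points `P` and rays `R`. -/
def IsReconstruction (P R : Finset Pt) (Eres : Set Ineq) : Prop :=
  ∃ M s : ℝ, IsGreatest {t | ∃ p ∈ P, t = |p.1| ∨ t = |p.2|} M ∧ s = M + 1 ∧
    ((∃ p, boxedPoints P R s = {p} ∧ Eres = pointIneqs p) ∨
     ((∀ p, boxedPoints P R s ≠ {p}) ∧
      ∃ (n m : ℕ) (q : Fin n → Pt) (k : Fin m → Fin n),
        IsSorted (centroid (boxedPoints P R s)) (boxedPoints P R s) q ∧
        IsScan q k ∧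
        Eres = roundTrip s q k))

/-- `Eres` is a possible result of `hull(E₁, E₂)`, with `⟨P₁, R₁⟩` and `⟨P₂, R₂⟩` the results of
the two calls of `extreme` (which are not made if one of the inputs is empty). -/
def IsHullRun (E₁ E₂ : Set Ineq) (P₁ R₁ P₂ R₂ : Finset Pt) (Eres : Set Ineq) : Prop :=
  ((E₁ = ∅ ∨ E₂ = ∅) ∧ Eres = ∅) ∨
  (¬ (E₁ = ∅ ∨ E₂ = ∅) ∧ IsExtreme E₁ P₁ R₁ ∧ IsExtreme E₂ P₂ R₂ ∧
    IsReconstruction (P₁ ∪ P₂) (R₁ ∪ R₂) Eres)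

end

end PlanarHull

namespace PlanarHull

/-! Polyhedra are compared through the inequalities they satisfy, and these are tested on generators
by `ValidOn`. Two facts carry the theorem. By `IsExtreme.forall_holds_iff`, an inequality holds on
an input polyhedron exactly if it is valid on the extracted points and rays. By
`IsReconstruction.describes`, the emitted inequalities are valid on the united generators and imply
every valid inequality. Together they give inclusion and minimality. The generator description
follows by separation (`mem_convexHull_add_cone_iff`), since finitely generated cones are closed.

For the extraction, locate the normal of `f` among the sorted normals. Either it has the direction
of one of them, or it lies between two neighbours less than a half turn apart, where `f` is a
nonnegative combination of the two and is governed by their intersection point, or it lies in a gap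
of at least a half turn, where an emitted ray excludes it. Non-redundancy makes the intersection
points feasible.

For the reconstruction, translates along rays leave the box, so points of `Q` in the box belong to
`P`. An edge through such a point `p` bounds the rays as well, because `Q` contains the translates
of `p`. Conversely, a valid `f` is maximal on `Q` both at some `p ∈ P` and at a vertex. Each of the
two edges at that vertex needed to express `f` passes through `p`, so it was emitted. A segment
needs its line in both directions and a cap at each end in the box. -/

/-- The linear functional `(x, y) ↦ a x + b y` of an inequality. -/
noncomputable def dot (e : Ineq) : Pt →ₗ[ℝ] ℝ :=
  e.a • LinearMap.fst ℝ ℝ ℝ + e.b • LinearMap.snd ℝ ℝ ℝ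

@[simp] theorem dot_apply (e : Ineq) (p : Pt) : dot e p = e.a * p.1 + e.b * p.2 := by
  simp [dot]

theorem holds_iff (p : Pt) (e : Ineq) : Holds p e ↔ dot e p ≤ e.c := by simp [Holds]

theorem saturates_iff (p : Pt) (e : Ineq) : Saturates p e ↔ dot e p = e.c := by simp [Saturates]

/-- The inequality `f` holds on the points `P` and its functional is nonpositive on the rays `R`. -/
def ValidOn (P R : Finset Pt) (f : Ineq) : Prop :=
  (∀ p ∈ P, Holds p f) ∧ ∀ r ∈ R, dot f r ≤ 0

theorem convex_holds (f : Ineq) : Convex ℝ {p | Holds p f} := by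
  simpa [holds_iff] using convex_halfSpace_le (dot f).isLinear f.c

/-! ### Finitely generated cones and separation. -/

theorem cone_mono {S R : Finset Pt} (h : S ⊆ R) : cone S ⊆ cone R := by
  classical
  rintro x ⟨w, hw, rfl⟩
  refine ⟨fun r => if r ∈ S then w r else 0, fun r _ => ?_, ?_⟩
  · dsimp only
    split_ifs with hr
    · exact hw r hr
    · exact le_rfl
  · rw [← Finset.sum_subset h (fun r _ hr => by simp [hr])]
    exact Finset.sum_congr rfl fun r hr => by simp [hr]

/-- The cone is the image of the closed orthant under an injective linear map, which is a closed
embedding in finite dimension. -/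
theorem isClosed_cone_of_linearIndependent {R : Finset Pt}
    (h : LinearIndependent ℝ ((↑) : R → Pt)) : IsClosed (cone R) := by
  have hinj : Function.Injective (Fintype.linearCombination ℝ ((↑) : R → Pt)) :=
    linearIndependent_iff_injective_fintypeLinearCombination.1 h
  have hcl := (LinearMap.isClosedEmbedding_of_injective
    (LinearMap.ker_eq_bot.2 hinj)).isClosedMap {w : R → ℝ | ∀ i, 0 ≤ w i}
    (by simpa only [Set.ofPred_forall] using
      isClosed_iInter fun i => isClosed_le continuous_const (continuous_apply i))
  convert hcl using 1
  ext x
  constructor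
  · rintro ⟨w, hw, rfl⟩
    refine ⟨fun r => w r, fun r => hw r r.2, ?_⟩
    rw [Fintype.linearCombination_apply, ← Finset.sum_coe_sort R (fun r => w r • r)]
  · rintro ⟨w, hw, rfl⟩
    classical
    refine ⟨fun r => if hr : r ∈ R then w ⟨r, hr⟩ else 0, fun r hr => by simpa [hr] using hw _, ?_⟩
    rw [Fintype.linearCombination_apply,
      ← Finset.sum_coe_sort R (fun r => (if hr : r ∈ R then w ⟨r, hr⟩ else 0) • r)]
    exact Finset.sum_congr rfl fun r _ => by simp

/-- Carathéodory's reduction: subtract a multiple of a linear relation until the first weight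
reaches zero. -/
theorem cone_subset_iUnion_erase {R : Finset Pt} (h : ¬ LinearIndependent ℝ ((↑) : R → Pt)) :
    cone R ⊆ ⋃ r ∈ R, cone (R.erase r) := by
  classical
  obtain ⟨g, hg0, hgpos⟩ : ∃ g : Pt → ℝ, ∑ r ∈ R, g r • r = 0 ∧ ∃ r ∈ R, 0 < g r := by
    obtain ⟨g, hg, i, hi⟩ := Fintype.not_linearIndependent_iff.1 h
    have hsum : ∑ r ∈ R, (if hr : r ∈ R then g ⟨r, hr⟩ else 0) • r = 0 := by
      rw [← Finset.sum_coe_sort R (fun r => (if hr : r ∈ R then g ⟨r, hr⟩ else 0) • r), ← hg]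
      exact Finset.sum_congr rfl fun r _ => by simp
    rcases lt_or_gt_of_ne hi with hi | hi
    · refine ⟨fun r => -(if hr : r ∈ R then g ⟨r, hr⟩ else 0), ?_, i, i.2, by simpa using hi⟩
      simp only [neg_smul, Finset.sum_neg_distrib, hsum, neg_zero]
    · exact ⟨_, hsum, i, i.2, by simpa using hi⟩
  rintro x ⟨w, hw, rfl⟩
  -- The minimal ratio is the largest multiple of the relation that keeps all weights nonnegative.
  obtain ⟨r₀, hr₀, hmin⟩ := (R.filter fun r => 0 < g r).exists_min_image (fun r => w r / g r)
    (by obtain ⟨r, hr, h⟩ := hgpos; exact ⟨r, by simp [hr, h]⟩)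
  rw [Finset.mem_filter] at hr₀
  set t := w r₀ / g r₀ with ht
  have ht0 : 0 ≤ t := div_nonneg (hw _ hr₀.1) hr₀.2.le
  refine Set.mem_biUnion hr₀.1 ⟨fun r => w r - t * g r, fun r hr => ?_, ?_⟩
  · have hrR := Finset.mem_of_mem_erase hr
    by_cases hpos : 0 < g r
    · have := hmin r (by simp [hrR, hpos])
      rw [le_div_iff₀ hpos] at this
      simpa using this
    · have := mul_nonneg ht0 (neg_nonneg.2 (not_lt.1 hpos))
      have := hw r hrR
      dsimp only
      linarith
  · have h0 : w r₀ - t * g r₀ = 0 := by rw [ht, div_mul_cancel₀ _ hr₀.2.ne', sub_self]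
    rw [Finset.sum_erase _ (by simp [h0])]
    simp only [sub_smul, mul_smul, Finset.sum_sub_distrib, ← Finset.smul_sum, hg0, smul_zero,
      sub_zero]

theorem isClosed_cone (R : Finset Pt) : IsClosed (cone R) := by
  classical
  induction R using Finset.strongInduction with
  | H R ih =>
    by_cases h : LinearIndependent ℝ ((↑) : R → Pt)
    · exact isClosed_cone_of_linearIndependent h
    · rw [(cone_subset_iUnion_erase h).antisymm
        (Set.iUnion₂_subset fun r _ => cone_mono (R.erase_subset r))]
      exact R.finite_toSet.isClosed_biUnion fun r hr => ih _ (Finset.erase_ssubset hr)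

theorem zero_mem_cone (R : Finset Pt) : (0 : Pt) ∈ cone R :=
  ⟨0, fun _ _ => le_rfl, by simp⟩

theorem smul_mem_cone {R : Finset Pt} {r : Pt} (hr : r ∈ R) {t : ℝ} (ht : 0 ≤ t) :
    t • r ∈ cone R := by
  classical
  refine ⟨fun s => if s = r then t else 0, fun s _ => ?_, ?_⟩
  · dsimp only
    split_ifs
    · exact ht
    · exact le_rfl
  · simp [ite_smul, hr]

theorem convex_cone (R : Finset Pt) : Convex ℝ (cone R) := by
  rintro x ⟨w, hw, rfl⟩ y ⟨v, hv, rfl⟩ a b ha hb -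
  refine ⟨fun r => a * w r + b * v r,
    fun r hr => add_nonneg (mul_nonneg ha (hw r hr)) (mul_nonneg hb (hv r hr)), ?_⟩
  simp only [Finset.smul_sum, add_smul, mul_smul, Finset.sum_add_distrib]

/-- If `dot f` is bounded above along a ray then it is nonpositive on the direction. -/
theorem nonpos_of_forall_add_mul_le {a b c : ℝ} (h : ∀ t : ℝ, 0 ≤ t → a + t * b ≤ c) : b ≤ 0 := by
  by_contra hb
  push Not at hb
  have h0 := h 0 le_rfl
  have := h ((c - a + 1) / b) (div_nonneg (by linarith) hb.le)
  rw [div_mul_cancel₀ _ hb.ne'] at this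
  linarith

/-- A compact set plus a closed cone is closed and convex, so a point outside it is cut off by a
functional. Being bounded above on the set, this functional is nonpositive on the rays. -/
theorem mem_convexHull_add_cone_iff {P R : Finset Pt} (hP : P.Nonempty) (x : Pt) :
    x ∈ convexHull ℝ (P : Set Pt) + cone R ↔ ∀ f, ValidOn P R f → Holds x f := by
  constructor
  · rintro ⟨u, hu, v, ⟨w, hw, rfl⟩, rfl⟩ f ⟨hfP, hfR⟩
    have h1 : Holds u f := convexHull_min (t := {p | Holds p f}) hfP (convex_holds f) hu
    rw [holds_iff] at h1 ⊢
    have h2 : dot f (∑ r ∈ R, w r • r) ≤ 0 := by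
      rw [map_sum]
      refine Finset.sum_nonpos fun r hr => ?_
      rw [map_smul, smul_eq_mul]
      exact mul_nonpos_of_nonneg_of_nonpos (hw r hr) (hfR r hr)
    change dot f (u + _) ≤ _
    rw [map_add]
    linarith
  · intro h
    by_contra hx
    have hcl : IsClosed (convexHull ℝ (P : Set Pt) + cone R) := by
      rw [add_comm]
      exact (isClosed_cone R).add_right_of_isCompact (P.finite_toSet.isCompact_convexHull ℝ)
    obtain ⟨g, c, hg, hgx⟩ := geometric_hahn_banach_closed_point
      ((convex_convexHull ℝ _).add (convex_cone R)) hcl hx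
    have hgd : ∀ p : Pt, g p = dot ⟨g (1, 0), g (0, 1), c⟩ p := by
      intro p
      have : p = p.1 • ((1, 0) : Pt) + p.2 • ((0, 1) : Pt) := by ext <;> simp
      conv_lhs => rw [this, map_add, map_smul, map_smul]
      simp [mul_comm]
    refine absurd (h ⟨g (1, 0), g (0, 1), c⟩ ⟨fun p hp => ?_, fun r hr => ?_⟩) ?_
    · rw [holds_iff, ← hgd]
      exact (hg p ⟨p, subset_convexHull _ _ hp, 0, zero_mem_cone R, add_zero p⟩).le
    · obtain ⟨p, hp⟩ := hP
      rw [← hgd]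
      refine nonpos_of_forall_add_mul_le (a := g p) (c := c) fun t ht => ?_
      have := hg _ ⟨p, subset_convexHull _ _ hp, t • r, smul_mem_cone hr ht, rfl⟩
      change g (p + t • r) < c at this
      rw [map_add, map_smul, smul_eq_mul] at this
      exact this.le
    · rw [holds_iff, ← hgd]
      exact not_le.2 hgx

/-! ### Angles and cross products. -/

/-- The cross product of the normal vectors of two inequalities. -/
def cross (e₁ e₂ : Ineq) : ℝ := e₁.a * e₂.b - e₁.b * e₂.a

theorem cross_swap (e₁ e₂ : Ineq) : cross e₂ e₁ = -cross e₁ e₂ := by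
  unfold cross; ring

/-- Cramer's rule with cleared denominator: the signs of the two coefficients tell whether `f` is a
nonnegative combination of `e₁` and `e₂`. -/
theorem cross_mul_dot (e₁ e₂ f : Ineq) (p : Pt) :
    cross e₁ e₂ * dot f p = cross f e₂ * dot e₁ p + cross e₁ f * dot e₂ p := by
  simp only [cross, dot_apply]; ring

theorem theta_mem (e : Ineq) : 0 ≤ theta e ∧ theta e < 2 * Real.pi := by
  simpa [theta] using toIcoMod_mem_Ico Real.two_pi_pos 0 (Complex.arg ⟨e.a, e.b⟩)

theorem exists_polar {e : Ineq} (he : e ∈ Lin) :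
    ∃ ρ : ℝ, 0 < ρ ∧ e.a = ρ * Real.cos (theta e) ∧ e.b = ρ * Real.sin (theta e) := by
  obtain ⟨-, hc, hs⟩ := theta_spec e he
  have hpos : 0 < √(e.a ^ 2 + e.b ^ 2) := by
    apply Real.sqrt_pos.2
    rcases he with h | h <;> positivity
  exact ⟨_, hpos, by rw [hc]; field_simp, by rw [hs]; field_simp⟩

/-- The angle `y` is less than a half turn ahead of the angle `x`, for angles in `[0, 2π)`. -/
def Ahead (x y : ℝ) : Prop := (x < y ∧ y < x + Real.pi) ∨ y < x - Real.pi

theorem sin_sub_pos_iff {x y : ℝ} (hx : 0 ≤ x ∧ x < 2 * Real.pi) (hy : 0 ≤ y ∧ y < 2 * Real.pi) :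
    0 < Real.sin (y - x) ↔ Ahead x y := by
  have hπ := Real.pi_pos
  constructor
  · intro h
    unfold Ahead
    by_contra hcon
    push Not at hcon
    obtain ⟨h1, h2⟩ := hcon
    rcases lt_or_ge x y with hxy | hxy
    · have h3 := h1 hxy
      have := Real.sin_nonneg_of_nonneg_of_le_pi (x := y - x - Real.pi) (by linarith) (by linarith)
      rw [Real.sin_sub_pi] at this
      linarith
    · have := Real.sin_nonpos_of_nonpos_of_neg_pi_le (x := y - x) (by linarith) (by linarith)
      linarith
  · rintro (⟨h1, h2⟩ | h)
    · exact Real.sin_pos_of_pos_of_lt_pi (by linarith) (by linarith)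
    · rw [← Real.sin_add_two_pi]
      exact Real.sin_pos_of_pos_of_lt_pi (by linarith) (by linarith)

theorem cross_pos_iff {e₁ e₂ : Ineq} (h₁ : e₁ ∈ Lin) (h₂ : e₂ ∈ Lin) :
    0 < cross e₁ e₂ ↔ Ahead (theta e₁) (theta e₂) := by
  obtain ⟨ρ, hρ, ha, hb⟩ := exists_polar h₁
  obtain ⟨σ, hσ, ha', hb'⟩ := exists_polar h₂
  rw [← sin_sub_pos_iff (theta_mem _) (theta_mem _)]
  have : cross e₁ e₂ = ρ * σ * Real.sin (theta e₂ - theta e₁) := by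
    rw [cross, ha, hb, ha', hb', Real.sin_sub]; ring
  rw [this]
  exact mul_pos_iff_of_pos_left (mul_pos hρ hσ)

theorem exists_pos_smul_of_theta_eq {e₁ e₂ : Ineq} (h₁ : e₁ ∈ Lin) (h₂ : e₂ ∈ Lin)
    (h : theta e₁ = theta e₂) : ∃ t : ℝ, 0 < t ∧ e₂.a = t * e₁.a ∧ e₂.b = t * e₁.b := by
  obtain ⟨ρ, hρ, ha, hb⟩ := exists_polar h₁
  obtain ⟨σ, hσ, ha', hb'⟩ := exists_polar h₂
  refine ⟨σ / ρ, div_pos hσ hρ, ?_, ?_⟩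
  · rw [ha, ha', h]; field_simp
  · rw [hb, hb', h]; field_simp

theorem exists_neg_smul_of_cross_eq_zero {e₁ e₂ : Ineq} (h₁ : e₁ ∈ Lin) (h₂ : e₂ ∈ Lin)
    (h0 : cross e₁ e₂ = 0) (h : theta e₁ ≠ theta e₂) :
    ∃ t : ℝ, 0 < t ∧ e₂.a = -t * e₁.a ∧ e₂.b = -t * e₁.b := by
  have h12 : ¬ Ahead (theta e₁) (theta e₂) := by
    rw [← cross_pos_iff h₁ h₂, h0]; exact lt_irrefl 0
  have h21 : ¬ Ahead (theta e₂) (theta e₁) := by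
    rw [← cross_pos_iff h₂ h₁, cross_swap, h0, neg_zero]; exact lt_irrefl 0
  obtain ⟨ρ, hρ, ha, hb⟩ := exists_polar h₁
  obtain ⟨σ, hσ, ha', hb'⟩ := exists_polar h₂
  have hc : Real.cos (theta e₂) = -Real.cos (theta e₁) ∧
      Real.sin (theta e₂) = -Real.sin (theta e₁) := by
    unfold Ahead at h12 h21
    push Not at h12 h21
    rcases lt_or_gt_of_ne h with hlt | hlt
    · have : theta e₂ = theta e₁ + Real.pi := by linarith [h12.1 hlt, h21.2]
      rw [this]; simp
    · have : theta e₂ = theta e₁ - Real.pi := by linarith [h21.1 hlt, h12.2]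
      rw [this]; simp
  refine ⟨σ / ρ, div_pos hσ hρ, ?_, ?_⟩
  · rw [ha, ha', hc.1]; field_simp
  · rw [hb, hb', hc.2]; field_simp

/-- Equal orientations must be excluded: there `ang` is `0`, yet neither angle is ahead of the
other. -/
theorem pi_le_ang_iff {e₁ e₂ : Ineq} (h : theta e₁ ≠ theta e₂) :
    Real.pi ≤ ang e₁ e₂ ↔ ¬ Ahead (theta e₁) (theta e₂) := by
  have hπ := Real.pi_pos
  obtain ⟨hx0, hx⟩ := theta_mem e₁
  obtain ⟨hy0, hy⟩ := theta_mem e₂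
  unfold ang Ahead
  rcases lt_or_gt_of_ne h with hlt | hlt
  · have : toIcoMod Real.two_pi_pos 0 (theta e₂ - theta e₁) = theta e₂ - theta e₁ := by
      rw [toIcoMod_eq_iff]
      exact ⟨⟨by linarith, by linarith⟩, 0, by simp⟩
    rw [this]
    constructor
    · rintro h1 (⟨h2, h3⟩ | h2) <;> linarith
    · intro h1
      push Not at h1
      linarith [h1.1 hlt]
  · have : toIcoMod Real.two_pi_pos 0 (theta e₂ - theta e₁)
        = theta e₂ - theta e₁ + 2 * Real.pi := by
      rw [toIcoMod_eq_iff]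
      exact ⟨⟨by linarith, by linarith⟩, -1, by simp⟩
    rw [this]
    constructor
    · rintro h1 (⟨h2, h3⟩ | h2) <;> linarith
    · intro h1
      push Not at h1
      linarith [h1.2]

/-! ### Cyclic sequences of angles. -/

section Cyclic

variable {n : ℕ}

theorem cyc_one_val (i : Fin n) :
    (i.val + 1 < n ∧ (cyc i 1).val = i.val + 1) ∨ (i.val + 1 = n ∧ (cyc i 1).val = 0) := by
  rcases Nat.lt_or_ge (i.val + 1) n with h | h
  · exact .inl ⟨h, Nat.mod_eq_of_lt h⟩
  · have h' : i.val + 1 = n := by have := i.isLt; omega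
    exact .inr ⟨h', by simp [cyc, h']⟩

theorem cyc_sub_one_cyc_one (i : Fin n) : cyc (cyc i (n - 1)) 1 = i := by
  have := i.isLt
  ext
  simp only [cyc, Nat.mod_add_mod]
  rw [show i.val + (n - 1) + 1 = i.val + n by omega, Nat.add_mod_right, Nat.mod_eq_of_lt this]

theorem cyc_one_cyc_sub_one (i : Fin n) : cyc (cyc i 1) (n - 1) = i := by
  have := i.isLt
  ext
  simp only [cyc, Nat.mod_add_mod]
  rw [show i.val + 1 + (n - 1) = i.val + n by omega, Nat.add_mod_right, Nat.mod_eq_of_lt this]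

theorem cyc_one_ne {i : Fin n} (hn : n ≠ 1) : cyc i 1 ≠ i := by
  intro h
  have := congrArg Fin.val h
  rcases cyc_one_val i with h' | h' <;> omega

variable {θ : Fin n → ℝ}

/-- The cyclic successor is the nearest angle counter-clockwise. Hence a flag that looks at the
neighbour only controls all indices. -/
theorem ahead_cyc_one_of_ahead (hθ : StrictMono θ) (hb : ∀ i, 0 ≤ θ i ∧ θ i < 2 * Real.pi)
    {i j : Fin n} (h : Ahead (θ i) (θ j)) : Ahead (θ i) (θ (cyc i 1)) := by
  have hπ := Real.pi_pos
  have hi := hb i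
  have hi' := hb (cyc i 1)
  rcases cyc_one_val i with ⟨-, h1⟩ | ⟨h0, h1⟩
  · have hlt : θ i < θ (cyc i 1) := hθ (Fin.lt_def.2 (by omega))
    rcases h with ⟨h2, h3⟩ | h2
    · have hij := Fin.lt_def.1 (hθ.lt_iff_lt.1 h2)
      have : θ (cyc i 1) ≤ θ j := hθ.monotone (Fin.le_def.2 (by omega))
      exact .inl ⟨hlt, by linarith⟩
    · exact .inl ⟨hlt, by linarith [(hb j).1]⟩
  · have hle : θ (cyc i 1) ≤ θ j := hθ.monotone (Fin.le_def.2 (by omega))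
    have hji : θ j ≤ θ i := hθ.monotone (Fin.le_def.2 (by have := j.isLt; omega))
    rcases h with ⟨h2, h3⟩ | h2
    · linarith
    · exact .inr (by linarith)

theorem ahead_cyc_one_of_ahead' (hθ : StrictMono θ) (hb : ∀ i, 0 ≤ θ i ∧ θ i < 2 * Real.pi)
    {i j : Fin n} (h : Ahead (θ j) (θ (cyc i 1))) : Ahead (θ i) (θ (cyc i 1)) := by
  have hπ := Real.pi_pos
  have hi := hb i
  have hi' := hb (cyc i 1)
  rcases cyc_one_val i with ⟨-, h1⟩ | ⟨h0, h1⟩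
  · have hlt : θ i < θ (cyc i 1) := hθ (Fin.lt_def.2 (by omega))
    rcases h with ⟨h2, h3⟩ | h2
    · have hij := Fin.lt_def.1 (hθ.lt_iff_lt.1 h2)
      have : θ j ≤ θ i := hθ.monotone (Fin.le_def.2 (by omega))
      exact .inl ⟨hlt, by linarith⟩
    · exact .inl ⟨hlt, by linarith [(hb j).2]⟩
  · have hle : θ (cyc i 1) ≤ θ j := hθ.monotone (Fin.le_def.2 (by omega))
    have hji : θ j ≤ θ i := hθ.monotone (Fin.le_def.2 (by have := j.isLt; omega))
    rcases h with ⟨h2, h3⟩ | h2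
    · linarith
    · exact .inr (by linarith)

/-- Three angles within a half turn are in cyclic order. -/
theorem Ahead.cyclic_order {x y z : ℝ} (hx : x < 2 * Real.pi) (hz : 0 ≤ z) (hxy : Ahead x y)
    (hyz : Ahead y z) (hxz : Ahead x z) :
    (x < y ∧ y < z) ∨ (y < z ∧ z < x) ∨ (z < x ∧ x < y) := by
  have hπ := Real.pi_pos
  rcases hxy with ⟨h1, h2⟩ | h1 <;> rcases hyz with ⟨h3, h4⟩ | h3
  · exact .inl ⟨h1, h3⟩
  · exact .inr (.inr ⟨by linarith, h1⟩)
  · rcases hxz with ⟨h5, h6⟩ | h5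
    · linarith
    · exact .inr (.inl ⟨h3, by linarith⟩)
  · rcases hxz with ⟨h5, h6⟩ | h5 <;> linarith

theorem not_ahead_between (hθ : StrictMono θ) (hb : ∀ i, 0 ≤ θ i ∧ θ i < 2 * Real.pi) {i j : Fin n}
    (h : Ahead (θ i) (θ (cyc i 1))) (h1 : Ahead (θ i) (θ j))
    (h2 : Ahead (θ j) (θ (cyc i 1))) : False := by
  have hj := j.isLt
  rcases h1.cyclic_order (hb i).2 (hb _).1 h2 h with ⟨h3, h4⟩ | ⟨h3, h4⟩ | ⟨h3, h4⟩ <;>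
    rw [hθ.lt_iff_lt, Fin.lt_def] at h3 h4 <;>
    rcases cyc_one_val i with h' | h' <;> omega

/-- Where an arbitrary angle is located with respect to a cyclic sequence of angles. -/
theorem exists_cyclic_position (hθ : StrictMono θ) (hb : ∀ i, 0 ≤ θ i ∧ θ i < 2 * Real.pi)
    (hn : 2 ≤ n) {φ : ℝ} (hφ : 0 ≤ φ ∧ φ < 2 * Real.pi) :
    ∃ i, θ i = φ ∨
      (Ahead (θ i) (θ (cyc i 1)) ∧ ¬ Ahead (θ (cyc i 1)) φ ∧ ¬ Ahead φ (θ i)) ∨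
      (¬ Ahead (θ i) (θ (cyc i 1)) ∧ (Ahead (θ i) φ ∨ Ahead φ (θ (cyc i 1)))) := by
  have hπ := Real.pi_pos
  by_cases hex : ∃ i, θ i = φ
  · exact ⟨hex.choose, .inl hex.choose_spec⟩
  push Not at hex
  -- The second alternative is the arc from the last angle through `0` to the first.
  obtain ⟨i, hi⟩ : ∃ i : Fin n, (θ i < φ ∧ φ < θ (cyc i 1)) ∨
      (θ (cyc i 1) < θ i ∧ (θ i < φ ∨ φ < θ (cyc i 1))) := by
    let l : Fin n := ⟨n - 1, by omega⟩
    have hl : (cyc l 1).val = 0 := by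
      rcases cyc_one_val l with h | h <;> simp only [l] at h ⊢ <;> omega
    have hll : θ (cyc l 1) < θ l := hθ (Fin.lt_def.2 (by simp only [l, hl]; omega))
    by_cases h0 : ∃ i, θ i < φ
    · obtain ⟨i, hi, hmax⟩ := (Finset.univ.filter fun i => θ i < φ).exists_max_image id
        (by obtain ⟨i, h⟩ := h0; exact ⟨i, by simp [h]⟩)
      simp only [Finset.mem_filter, Finset.mem_univ, true_and, id] at hi hmax
      rcases cyc_one_val i with ⟨-, h1⟩ | ⟨h2, h1⟩
      · refine ⟨i, .inl ⟨hi, lt_of_le_of_ne ?_ (hex _).symm⟩⟩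
        by_contra hlt
        have := Fin.le_def.1 (hmax _ (not_le.1 hlt))
        omega
      · exact ⟨i, .inr ⟨hθ (Fin.lt_def.2 (by omega)), .inl hi⟩⟩
    · push Not at h0
      exact ⟨l, .inr ⟨hll, .inr (lt_of_le_of_ne (h0 _) (hex _).symm)⟩⟩
  refine ⟨i, .inr ?_⟩
  have h1 := hb i
  have h2 := hb (cyc i 1)
  by_cases hA : Ahead (θ i) (θ (cyc i 1))
  · refine .inl ⟨hA, ?_⟩
    unfold Ahead at hA ⊢
    constructor
    · rintro (⟨h3, h4⟩ | h3) <;> rcases hA with ⟨h5, h6⟩ | h5 <;>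
        rcases hi with ⟨h7, h8⟩ | ⟨h7, h8 | h8⟩ <;> linarith
    · rintro (⟨h3, h4⟩ | h3) <;> rcases hA with ⟨h5, h6⟩ | h5 <;>
        rcases hi with ⟨h7, h8⟩ | ⟨h7, h8 | h8⟩ <;> linarith
  · refine .inr ⟨hA, ?_⟩
    by_contra hcon
    unfold Ahead at hA hcon
    push Not at hA hcon
    obtain ⟨⟨h3, h4⟩, h5, h6⟩ := hcon
    rcases hi with ⟨h7, h8⟩ | ⟨h7, h8 | h8⟩
    · linarith [h3 h7, h5 h8]
    · linarith [h3 h8]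
    · linarith [h5 h8]

end Cyclic

/-! ### From inequalities to points and rays. -/

theorem NonRedundant.exists_violating {E : Set Ineq} (h : NonRedundant E) {e : Ineq} (he : e ∈ E) :
    ∃ x, (∀ e' ∈ E, e' ≠ e → Holds x e') ∧ ¬ Holds x e := by
  by_contra hcon
  push Not at hcon
  refine h e he (Set.Subset.antisymm (fun x hx e' he' => ?_) fun x hx e' he' => hx e' he'.1)
  by_cases heq : e' = e
  · exact heq ▸ hcon x fun e' he' hne => hx e' ⟨he', hne⟩
  · exact hx e' ⟨he', heq⟩

/-- Of two inequalities with the same direction, the weaker is implied by the other. This is what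
makes a strictly sorted listing possible. -/
theorem theta_injOn {E : Set Ineq} (hL : E ⊆ Lin) (hnr : NonRedundant E) : Set.InjOn theta E := by
  intro e he e' he' h
  by_contra hne
  obtain ⟨t, ht, ha, hb⟩ := exists_pos_smul_of_theta_eq (hL he) (hL he') h
  have hdot : ∀ p, dot e' p = t * dot e p := fun p => by simp only [dot_apply, ha, hb]; ring
  obtain ⟨x, hx, hxe⟩ := hnr.exists_violating he
  obtain ⟨y, hy, hye⟩ := hnr.exists_violating he'
  have h1 := hx e' he' (Ne.symm hne)
  have h2 := hy e he hne
  rw [holds_iff] at h1 h2 hxe hye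
  rw [hdot] at h1 hye
  have h3 : t * dot e y ≤ t * e.c := mul_le_mul_of_nonneg_left h2 ht.le
  have h4 : t * e.c < t * dot e x := mul_lt_mul_of_pos_left (not_le.1 hxe) ht
  linarith

/-- The intersection point of the boundary lines of two inequalities that are adjacent by angle
satisfies every other inequality of a satisfiable and non-redundant set. -/
theorem holds_of_mem_intersect {E : Set Ineq} (hsat : Satisfiable E) (hnr : NonRedundant E)
    {e₁ e₂ e : Ineq} (h₁ : e₁ ∈ E) (h₂ : e₂ ∈ E) (he : e ∈ E) (hpos : 0 < cross e₁ e₂)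
    (hbetween : ¬ (0 < cross e₁ e ∧ 0 < cross e e₂)) {p : Pt} (hp : p ∈ intersect e₁ e₂) :
    Holds p e := by
  obtain ⟨hp1, hp2⟩ := hp
  rw [saturates_iff] at hp1 hp2
  have hp := cross_mul_dot e₁ e₂ e p
  rw [hp1, hp2] at hp
  rw [holds_iff]
  -- The coefficients of `e` with respect to `e₁`, `e₂` are not both positive. If both are
  -- nonpositive, `dot e` at `p` is at most its value at any feasible point. If exactly one is
  -- positive and `p` violated `e`, then `e` and the inequality with nonpositive coefficient would
  -- imply the remaining one, against non-redundancy.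
  rcases le_or_gt (cross e e₂) 0 with hα | hα
  · rcases le_or_gt (cross e₁ e) 0 with hβ | hβ
    · obtain ⟨x, hx⟩ := hsat
      have hx1 := (holds_iff _ _).1 (hx e₁ h₁)
      have hx2 := (holds_iff _ _).1 (hx e₂ h₂)
      have hxe := (holds_iff _ _).1 (hx e he)
      have := cross_mul_dot e₁ e₂ e x
      have h3 : cross e₁ e₂ * dot e p ≤ cross e₁ e₂ * dot e x := by
        rw [hp, this]
        exact add_le_add (mul_le_mul_of_nonpos_left hx1 hα) (mul_le_mul_of_nonpos_left hx2 hβ)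
      exact (le_of_mul_le_mul_left h3 hpos).trans hxe
    · by_contra hcon
      have hne1 : e₁ ≠ e₂ := by rintro rfl; simp [cross, mul_comm] at hpos
      have hne : e ≠ e₂ := by rintro rfl; exact hcon hp2.le
      obtain ⟨x, hx, hxe⟩ := hnr.exists_violating h₂
      have hx1 := (holds_iff _ _).1 (hx e₁ h₁ hne1)
      have hx2 := (holds_iff _ _).1 (hx e he hne)
      rw [holds_iff, not_le] at hxe
      have := cross_mul_dot e₁ e₂ e x
      have h3 : cross e e₂ * e₁.c ≤ cross e e₂ * dot e₁ x := mul_le_mul_of_nonpos_left hx1 hα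
      have h4 : cross e₁ e * e₂.c < cross e₁ e * dot e₂ x := mul_lt_mul_of_pos_left hxe hβ
      have h5 : cross e₁ e₂ * dot e x < cross e₁ e₂ * dot e p :=
        mul_lt_mul_of_pos_left (hx2.trans_lt (not_le.1 hcon)) hpos
      linarith
  · have hβ : cross e₁ e ≤ 0 := by
      by_contra h
      exact hbetween ⟨not_le.1 h, hα⟩
    by_contra hcon
    have hne1 : e₂ ≠ e₁ := by rintro rfl; simp [cross, mul_comm] at hpos
    have hne : e ≠ e₁ := by rintro rfl; exact hcon hp1.le
    obtain ⟨x, hx, hxe⟩ := hnr.exists_violating h₁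
    have hx1 := (holds_iff _ _).1 (hx e₂ h₂ hne1)
    have hx2 := (holds_iff _ _).1 (hx e he hne)
    rw [holds_iff, not_le] at hxe
    have := cross_mul_dot e₁ e₂ e x
    have h3 : cross e₁ e * e₂.c ≤ cross e₁ e * dot e₂ x := mul_le_mul_of_nonpos_left hx1 hβ
    have h4 : cross e e₂ * e₁.c < cross e e₂ * dot e₁ x := mul_lt_mul_of_pos_left hxe hα
    have h5 : cross e₁ e₂ * dot e x < cross e₁ e₂ * dot e p :=
      mul_lt_mul_of_pos_left (hx2.trans_lt (not_le.1 hcon)) hpos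
    linarith

theorem intersect_eq_singleton {e₁ e₂ : Ineq} (h : cross e₁ e₂ ≠ 0) :
    ∃ p, intersect e₁ e₂ = {p} := by
  refine ⟨((e₁.c * e₂.b - e₁.b * e₂.c) / cross e₁ e₂,
    (e₁.a * e₂.c - e₁.c * e₂.a) / cross e₁ e₂), ?_⟩
  ext ⟨x, y⟩
  simp only [intersect, Saturates, Set.mem_ofPred_eq, Set.mem_singleton_iff, Prod.mk.injEq]
  rw [eq_div_iff h, eq_div_iff h]
  constructor
  · rintro ⟨h1, h2⟩
    rw [← h1, ← h2, cross]
    constructor <;> ring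
  · rintro ⟨h1, h2⟩
    constructor <;> apply mul_right_cancel₀ h <;> unfold cross at *
    · linear_combination e₁.a * h1 + e₁.b * h2
    · linear_combination e₂.a * h1 + e₂.b * h2

section Sorted

variable {n : ℕ} {e : Fin n → Ineq}

/-- The case `n = 1` is absorbed: the successor is then the inequality itself and the cross product
vanishes. -/
theorem dPost_iff (hL : ∀ i, e i ∈ Lin) (hθ : StrictMono fun i => theta (e i)) (i : Fin n) :
    DPost e i ↔ ¬ 0 < cross (e i) (e (cyc i 1)) := by
  unfold DPost
  rcases eq_or_ne n 1 with h | h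
  · subst h
    rw [Subsingleton.elim (cyc i 1) i]
    simp [cross, mul_comm]
  · have hne : theta (e i) ≠ theta (e (cyc i 1)) := hθ.injective.ne (cyc_one_ne h).symm
    simp [h, pi_le_ang_iff hne, cross_pos_iff (hL _) (hL _)]

theorem dPre_iff (hL : ∀ i, e i ∈ Lin) (hθ : StrictMono fun i => theta (e i)) (i : Fin n) :
    DPre e i ↔ ¬ 0 < cross (e (cyc i (n - 1))) (e i) := by
  have h := dPost_iff hL hθ (cyc i (n - 1))
  rwa [DPost, cyc_sub_one_cyc_one] at h

theorem cross_nonpos_of_dPost (hL : ∀ i, e i ∈ Lin) (hθ : StrictMono fun i => theta (e i))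
    {i : Fin n} (h : DPost e i) (j : Fin n) : cross (e i) (e j) ≤ 0 := by
  rw [dPost_iff hL hθ, cross_pos_iff (hL _) (hL _)] at h
  rw [← not_lt, cross_pos_iff (hL _) (hL _)]
  exact fun h' => h (ahead_cyc_one_of_ahead hθ (fun i => theta_mem _) h')

theorem cross_nonpos_of_dPre (hL : ∀ i, e i ∈ Lin) (hθ : StrictMono fun i => theta (e i))
    {i : Fin n} (h : DPre e i) (j : Fin n) : cross (e j) (e i) ≤ 0 := by
  rw [dPre_iff hL hθ, cross_pos_iff (hL _) (hL _)] at h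
  rw [← not_lt, cross_pos_iff (hL _) (hL _)]
  intro h'
  have := ahead_cyc_one_of_ahead' hθ (fun i => theta_mem _) (i := cyc i (n - 1)) (j := j)
  rw [cyc_sub_one_cyc_one] at this
  exact h (this h')

theorem not_cross_between (hL : ∀ i, e i ∈ Lin) (hθ : StrictMono fun i => theta (e i))
    {i : Fin n} (h : 0 < cross (e i) (e (cyc i 1))) (j : Fin n) :
    ¬ (0 < cross (e i) (e j) ∧ 0 < cross (e j) (e (cyc i 1))) := by
  simp only [cross_pos_iff (hL _) (hL _)] at h ⊢
  exact fun h' => not_ahead_between hθ (fun i => theta_mem _) h h'.1 h'.2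

theorem sqrt_pos_of_mem_lin {e : Ineq} (he : e ∈ Lin) : 0 < √(e.a ^ 2 + e.b ^ 2) := by
  apply Real.sqrt_pos.2
  rcases he with h | h <;> positivity

theorem dot_unit (f : Ineq) (u v : ℝ) :
    dot f (unit u v) = (f.a * u + f.b * v) / √(u ^ 2 + v ^ 2) := by
  simp only [dot_apply, unit]; ring

end Sorted

/-- The points and rays computed by `extreme` generate the polyhedron: an inequality holds on the
polyhedron iff it holds on the points and its functional is nonpositive on the rays. -/
theorem IsExtreme.forall_holds_iff {E : Set Ineq} {V R : Finset Pt} (h : IsExtreme E V R)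
    (hL : E ⊆ Lin) (hne : E.Nonempty) (hsat : Satisfiable E) (hnr : NonRedundant E) (f : Ineq) :
    (∀ x ∈ sol E, Holds x f) ↔ ValidOn V R f := by
  obtain ⟨n, e, v, rfl, hθ, hv, hV, hR⟩ := h
  have heL : ∀ i, e i ∈ Lin := fun i => hL ⟨i, rfl⟩
  have hmV : ∀ p, p ∈ V ↔ _ := fun p => Set.ext_iff.1 hV p
  have hmR : ∀ p, p ∈ R ↔ _ := fun p => Set.ext_iff.1 hR p
  simp only [Set.mem_ofPred_eq] at hmV hmR
  constructor
  · intro hf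
    constructor
    · intro p hp
      refine hf p ?_
      rintro _ ⟨j, rfl⟩
      obtain ⟨i, ⟨hi, hp⟩ | ⟨hpre, hpost, rfl⟩⟩ := (hmV p).1 hp
      · rw [dPost_iff heL hθ, not_not] at hi
        exact holds_of_mem_intersect hsat hnr ⟨_, rfl⟩ ⟨_, rfl⟩ ⟨j, rfl⟩ hi
          (not_cross_between heL hθ hi j) hp
      · have hvi := hv i
        rw [saturates_iff] at hvi
        rw [holds_iff]
        by_cases hij : i = j
        · exact hij ▸ hvi.le
        -- With both flags set, the normal of `e j` is opposite to that of `e i`. Any feasible point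
        -- then shows that the whole line of `e i` satisfies `e j`.
        have h0 : cross (e i) (e j) = 0 := by
          have h1 := cross_nonpos_of_dPost heL hθ hpost j
          have h2 := cross_nonpos_of_dPre heL hθ hpre j
          rw [cross_swap] at h2
          linarith
        obtain ⟨t, ht, ha, hb⟩ := exists_neg_smul_of_cross_eq_zero (heL i) (heL j) h0
          (hθ.injective.ne hij)
        have hdot : ∀ p, dot (e j) p = -t * dot (e i) p := fun p => by
          simp only [dot_apply, ha, hb]; ring
        obtain ⟨x, hx⟩ := hsat
        have hxi := (holds_iff _ _).1 (hx _ ⟨i, rfl⟩)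
        have hxj := (holds_iff _ _).1 (hx _ ⟨j, rfl⟩)
        rw [hdot] at hxj ⊢
        rw [hvi]
        exact (mul_le_mul_of_nonpos_left hxi (by linarith)).trans hxj
    · intro r hr
      -- The ray is a recession direction, so `f` stays bounded along it from any feasible point.
      have hrec : ∀ j, dot (e j) r ≤ 0 := by
        intro j
        obtain ⟨i, ⟨rfl, rfl⟩ | ⟨hpre, rfl⟩ | ⟨hpost, rfl⟩⟩ := (hmR r).1 hr
        · rw [Subsingleton.elim j i, dot_unit]
          refine div_nonpos_of_nonpos_of_nonneg ?_ (Real.sqrt_nonneg _)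
          nlinarith [sq_nonneg (e i).a, sq_nonneg (e i).b]
        · rw [dot_unit]
          refine div_nonpos_of_nonpos_of_nonneg ?_ (Real.sqrt_nonneg _)
          have := cross_nonpos_of_dPre heL hθ hpre j
          unfold cross at this
          linarith
        · rw [dot_unit]
          refine div_nonpos_of_nonpos_of_nonneg ?_ (Real.sqrt_nonneg _)
          have := cross_nonpos_of_dPost heL hθ hpost j
          unfold cross at this
          linarith
      obtain ⟨x, hx⟩ := hsat
      refine nonpos_of_forall_add_mul_le (a := dot f x) (c := f.c) fun t ht => ?_
      have : Holds (x + t • r) f := by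
        refine hf _ ?_
        rintro _ ⟨j, rfl⟩
        have hxj := (holds_iff _ _).1 (hx _ ⟨j, rfl⟩)
        rw [holds_iff, map_add, map_smul, smul_eq_mul]
        linarith [mul_nonpos_of_nonneg_of_nonpos ht (hrec j)]
      simpa only [holds_iff, map_add, map_smul, smul_eq_mul] using this
  · rintro ⟨hfV, hfR⟩ x hx
    -- Every boundary line carries a point of `V`, which settles any `f` whose normal is a
    -- nonnegative multiple of one of the given normals.
    have hsatV : ∀ i, ∃ p ∈ V, dot (e i) p = (e i).c := by
      intro i
      by_cases hpost : DPost e i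
      · by_cases hpre : DPre e i
        · exact ⟨v i, (hmV _).2 ⟨i, .inr ⟨hpre, hpost, rfl⟩⟩, (saturates_iff _ _).1 (hv i)⟩
        · have hpre' := hpre
          rw [dPre_iff heL hθ, not_not] at hpre
          obtain ⟨p, hp⟩ := intersect_eq_singleton hpre.ne'
          have hp' : p ∈ intersect (e (cyc i (n - 1))) (e i) := hp ▸ rfl
          refine ⟨p, (hmV _).2 ⟨cyc i (n - 1), .inl ⟨?_, ?_⟩⟩, (saturates_iff _ _).1 hp'.2⟩
          · rw [dPost_iff heL hθ, not_not, cyc_sub_one_cyc_one]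
            exact hpre
          · rwa [cyc_sub_one_cyc_one]
      · have hpost' := hpost
        rw [dPost_iff heL hθ, not_not] at hpost
        obtain ⟨p, hp⟩ := intersect_eq_singleton hpost.ne'
        have hp' : p ∈ intersect (e i) (e (cyc i 1)) := hp ▸ rfl
        exact ⟨p, (hmV _).2 ⟨i, .inl ⟨hpost', hp'⟩⟩, (saturates_iff _ _).1 hp'.1⟩
    have hpar : ∀ i t, 0 ≤ t → f.a = t * (e i).a → f.b = t * (e i).b → Holds x f := by
      intro i t ht ha hb
      obtain ⟨p, hpV, hp⟩ := hsatV i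
      have hdot : ∀ p, dot f p = t * dot (e i) p := fun p => by
        simp only [dot_apply, ha, hb]; ring
      have h1 := (holds_iff _ _).1 (hfV p hpV)
      have h2 := (holds_iff _ _).1 (hx _ ⟨i, rfl⟩)
      rw [hdot, hp] at h1
      rw [holds_iff, hdot]
      exact (mul_le_mul_of_nonneg_left h2 ht).trans h1
    have hpost : ∀ i, DPost e i → cross (e i) f ≤ 0 := by
      intro i hi
      have := hfR _ ((hmR _).2 ⟨i, .inr (.inr ⟨hi, rfl⟩)⟩)
      have hs := sqrt_pos_of_mem_lin (heL i)
      rw [dot_unit, neg_sq, add_comm ((e i).b ^ 2), div_le_iff₀ hs] at this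
      unfold cross
      linarith
    have hpre : ∀ i, DPre e i → cross f (e i) ≤ 0 := by
      intro i hi
      have := hfR _ ((hmR _).2 ⟨i, .inr (.inl ⟨hi, rfl⟩)⟩)
      have hs := sqrt_pos_of_mem_lin (heL i)
      rw [dot_unit, neg_sq, add_comm ((e i).b ^ 2), div_le_iff₀ hs] at this
      unfold cross
      linarith
    obtain ⟨_, i₀, -⟩ := hne
    by_cases hfL : f ∈ Lin
    · rcases eq_or_ne n 1 with rfl | hn1
      · have h0 : cross (e i₀) f = 0 := by
          have h1 := hpost i₀ (.inr rfl)
          have h2 := hpre i₀ (.inr rfl)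
          rw [cross_swap] at h2
          linarith
        by_cases hth : theta (e i₀) = theta f
        · obtain ⟨t, ht, ha, hb⟩ := exists_pos_smul_of_theta_eq (heL i₀) hfL hth
          exact hpar i₀ t ht.le ha hb
        · obtain ⟨t, ht, ha, hb⟩ := exists_neg_smul_of_cross_eq_zero (heL i₀) hfL h0 hth
          -- The ray pointing into the half-plane excludes the opposite normal.
          have := hfR _ ((hmR _).2 ⟨i₀, .inl ⟨rfl, rfl⟩⟩)
          have hs := sqrt_pos_of_mem_lin (heL i₀)
          rw [dot_unit, neg_sq, neg_sq, div_le_iff₀ hs, ha, hb] at this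
          have hs' : 0 < (e i₀).a ^ 2 + (e i₀).b ^ 2 := Real.sqrt_pos.1 hs
          nlinarith [mul_pos ht hs']
      · have hi₀ := i₀.isLt
        obtain ⟨i, hi | ⟨h1, h2, h3⟩ | ⟨h1, h2⟩⟩ :=
          exists_cyclic_position hθ (fun i => theta_mem _) (by omega) (theta_mem f)
        · obtain ⟨t, ht, ha, hb⟩ := exists_pos_smul_of_theta_eq (heL i) hfL hi
          exact hpar i t ht.le ha hb
        · rw [← cross_pos_iff (heL _) (heL _)] at h1
          rw [← cross_pos_iff (heL _) hfL, cross_swap, neg_pos, not_lt] at h2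
          rw [← cross_pos_iff hfL (heL _), cross_swap, neg_pos, not_lt] at h3
          obtain ⟨p, hp⟩ := intersect_eq_singleton h1.ne'
          have hp' : p ∈ intersect (e i) (e (cyc i 1)) := hp ▸ rfl
          have hpV : p ∈ V := (hmV _).2 ⟨i, .inl ⟨by rwa [dPost_iff heL hθ, not_not], hp'⟩⟩
          have hfp := (holds_iff _ _).1 (hfV p hpV)
          obtain ⟨hp1, hp2⟩ := hp'
          rw [saturates_iff] at hp1 hp2
          have e1 := cross_mul_dot (e i) (e (cyc i 1)) f p
          have e2 := cross_mul_dot (e i) (e (cyc i 1)) f x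
          have hx1 := (holds_iff _ _).1 (hx _ ⟨i, rfl⟩)
          have hx2 := (holds_iff _ _).1 (hx _ ⟨cyc i 1, rfl⟩)
          rw [hp1, hp2] at e1
          rw [holds_iff]
          refine le_trans (le_of_mul_le_mul_left ?_ h1) hfp
          rw [e1, e2]
          exact add_le_add (mul_le_mul_of_nonneg_left hx1 h2) (mul_le_mul_of_nonneg_left hx2 h3)
        · exfalso
          rw [← cross_pos_iff (heL _) (heL _)] at h1
          rw [← cross_pos_iff (heL _) hfL, ← cross_pos_iff hfL (heL _)] at h2
          rcases h2 with h2 | h2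
          · exact absurd (hpost i ((dPost_iff heL hθ i).2 h1)) (not_le.2 h2)
          · refine absurd (hpre (cyc i 1) ((dPre_iff heL hθ _).2 ?_)) (not_le.2 h2)
            rwa [cyc_one_cyc_sub_one]
    · simp only [Lin, Set.mem_ofPred_eq, not_or, not_not] at hfL
      -- A constant inequality is the multiple `0` of any given normal.
      exact hpar i₀ 0 le_rfl (by simp [hfL.1]) (by simp [hfL.2])

/-- Without points, the contradictory inequality `0 ≤ -1` would be valid on the generators and so
hold on a nonempty polyhedron. -/
theorem IsExtreme.points_nonempty {E : Set Ineq} {V R : Finset Pt} (h : IsExtreme E V R)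
    (hL : E ⊆ Lin) (hne : E.Nonempty) (hsat : Satisfiable E) (hnr : NonRedundant E) :
    V.Nonempty := by
  by_contra hV
  rw [Finset.not_nonempty_iff_eq_empty] at hV
  subst hV
  have := (h.forall_holds_iff hL hne hsat hnr ⟨0, 0, -1⟩).2 ⟨by simp, by simp⟩
  obtain ⟨x, hx⟩ := hsat
  have := this x hx
  norm_num [Holds] at this

theorem unit_norm {u v : ℝ} (h : 0 < √(u ^ 2 + v ^ 2)) :
    (unit u v).1 ^ 2 + (unit u v).2 ^ 2 = 1 := by
  have h' := Real.sqrt_pos.1 h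
  simp only [unit, div_pow, Real.sq_sqrt h'.le]
  rw [← add_div, div_self h'.ne']

theorem IsExtreme.ray_norm {E : Set Ineq} {V R : Finset Pt} (h : IsExtreme E V R) (hL : E ⊆ Lin)
    {r : Pt} (hr : r ∈ R) : r.1 ^ 2 + r.2 ^ 2 = 1 := by
  obtain ⟨n, e, v, rfl, hθ, hv, hV, hR⟩ := h
  have hs : ∀ i, 0 < √((e i).a ^ 2 + (e i).b ^ 2) := fun i => sqrt_pos_of_mem_lin (hL ⟨i, rfl⟩)
  obtain ⟨i, ⟨-, rfl⟩ | ⟨-, rfl⟩ | ⟨-, rfl⟩⟩ := (Set.ext_iff.1 hR r).1 hr <;>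
    refine unit_norm ?_ <;> simp only [neg_sq] <;> have := hs i
  · exact this
  · rwa [add_comm]
  · rwa [add_comm]

theorem exists_saturates {e : Ineq} (he : e ∈ Lin) : ∃ p, Saturates p e := by
  rcases he with h | h
  · exact ⟨(e.c / e.a, 0), by simp [Saturates, mul_div_cancel₀ _ h]⟩
  · exact ⟨(0, e.c / e.b), by simp [Saturates, mul_div_cancel₀ _ h]⟩

theorem exists_isExtreme {E : Set Ineq} (hL : E ⊆ Lin) (hfin : E.Finite) (hnr : NonRedundant E) :
    ∃ V R, IsExtreme E V R := by
  classical
  have hinj := theta_injOn hL hnr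
  obtain ⟨n, e, hrange, hθ⟩ : ∃ (n : ℕ) (e : Fin n → Ineq),
      Set.range e = E ∧ StrictMono fun i => theta (e i) := by
    have hmem : ∀ i, ∃ e ∈ E, theta e = (hfin.toFinset.image theta).orderEmbOfFin rfl i := by
      intro i
      obtain ⟨e, he, h⟩ := Finset.mem_image.1
        (Finset.orderEmbOfFin_mem (hfin.toFinset.image theta) rfl i)
      exact ⟨e, hfin.mem_toFinset.1 he, h⟩
    choose e he hth using hmem
    refine ⟨_, e, Set.Subset.antisymm (Set.range_subset_iff.2 he) fun x hx => ?_, fun i j hij => ?_⟩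
    · have : theta x ∈ Set.range ((hfin.toFinset.image theta).orderEmbOfFin rfl) := by
        rw [Finset.range_orderEmbOfFin]
        simpa using ⟨x, hx, rfl⟩
      obtain ⟨i, hi⟩ := this
      exact ⟨i, hinj (he i) hx (by rw [hth, hi])⟩
    · simp only [hth]
      exact (OrderEmbedding.strictMono _) hij
  subst hrange
  have heL : ∀ i, e i ∈ Lin := fun i => hL ⟨i, rfl⟩
  choose v hv using fun i => exists_saturates (heL i)
  have hVfin : {p | ∃ i, (¬ DPost e i ∧ p ∈ intersect (e i) (e (cyc i 1))) ∨
      (DPre e i ∧ DPost e i ∧ p = v i)}.Finite := by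
    rw [Set.ofPred_exists]
    refine Set.finite_iUnion fun i => ?_
    by_cases h : DPost e i
    · exact (Set.finite_singleton (v i)).subset fun p hp => by
        rcases hp with hp | hp
        · exact absurd h hp.1
        · exact hp.2.2
    · have h' := h
      rw [dPost_iff heL hθ, not_not] at h'
      obtain ⟨p, hp⟩ := intersect_eq_singleton h'.ne'
      exact (Set.finite_singleton p).subset fun x hx => by
        rcases hx with hx | hx
        · exact hp ▸ hx.2
        · exact absurd hx.2.1 h
  have hRfin : {r | ∃ i, (n = 1 ∧ r = unit (-(e i).a) (-(e i).b)) ∨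
      (DPre e i ∧ r = unit (e i).b (-(e i).a)) ∨
      (DPost e i ∧ r = unit (-(e i).b) (e i).a)}.Finite := by
    rw [Set.ofPred_exists]
    refine Set.finite_iUnion fun i => ?_
    refine (Set.toFinite {unit (-(e i).a) (-(e i).b), unit (e i).b (-(e i).a),
      unit (-(e i).b) (e i).a}).subset ?_
    rintro r (⟨-, h⟩ | ⟨-, h⟩ | ⟨-, h⟩) <;> simp [h]
  exact ⟨hVfin.toFinset, hRfin.toFinset, n, e, v, rfl, hθ, hv, hVfin.coe_toFinset,
    hRfin.coe_toFinset⟩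

/-! ### Orientation, vertices and the centroid. -/

/-- Twice the signed area of the triangle `x y z`. -/
def orient (x y z : Pt) : ℝ := (y.1 - x.1) * (z.2 - x.2) - (y.2 - x.2) * (z.1 - x.1)

theorem holds_connect_iff {x y z : Pt} : Holds z (connect x y) ↔ 0 ≤ orient x y z := by
  simp only [Holds, connect, orient]
  rw [← sub_nonneg]
  ring_nf

theorem saturates_connect_iff {x y z : Pt} : Saturates z (connect x y) ↔ orient x y z = 0 := by
  simp only [Saturates, connect, orient]
  rw [← sub_eq_zero, ← neg_eq_zero]
  ring_nf

/-- The normal of `connect c x` is `x - c` turned by a quarter, so sorting by `theta` sorts points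
around `c`. -/
theorem cross_connect (c x y : Pt) : cross (connect c x) (connect c y) = orient c x y := by
  simp only [cross, connect, orient]; ring

theorem connect_mem_lin {x y : Pt} (h : x ≠ y) : connect x y ∈ Lin := by
  by_contra hcon
  simp only [Lin, connect, Set.mem_ofPred_eq, not_or, not_not, sub_eq_zero] at hcon
  exact h (Prod.ext hcon.2 hcon.1.symm)

theorem vert_eq_extremePoints {S : Set Pt} (hS : Convex ℝ S) : vert S = S.extremePoints ℝ := by
  ext p
  rw [hS.mem_extremePoints_iff_mem_sdiff_convexHull_sdiff]
  rfl

/-- A vertex is not a convex combination of three other points. -/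
theorem vert_not_combination {S : Set Pt} {p x y z : Pt} (hp : p ∈ vert S)
    (hx : x ∈ S) (hy : y ∈ S) (hz : z ∈ S) (hxp : x ≠ p) (hyp : y ≠ p) (hzp : z ≠ p)
    {α β γ : ℝ} (hα : 0 ≤ α) (hβ : 0 ≤ β) (hγ : 0 ≤ γ) (hpos : 0 < α + β + γ)
    (h1 : (α + β + γ) * p.1 = α * x.1 + β * y.1 + γ * z.1)
    (h2 : (α + β + γ) * p.2 = α * x.2 + β * y.2 + γ * z.2) : False := by
  refine hp.2 ?_
  have hc := convex_convexHull ℝ (S \ {p})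
  have hsub := subset_convexHull ℝ (S \ {p})
  have key := hc.sum_mem (t := (Finset.univ : Finset (Fin 3)))
    (w := ![α / (α + β + γ), β / (α + β + γ), γ / (α + β + γ)]) (z := ![x, y, z])
    (by intro i _; fin_cases i <;> simp <;> positivity)
    (by simp [Fin.sum_univ_three]; field_simp)
    (by intro i _; fin_cases i
        · exact hsub ⟨hx, hxp⟩
        · exact hsub ⟨hy, hyp⟩
        · exact hsub ⟨hz, hzp⟩)
  convert key using 1
  ext
  · simp [Fin.sum_univ_three]
    field_simp
    linarith
  · simp [Fin.sum_univ_three]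
    field_simp
    linarith

/-- Three distinct points on a line are not all vertices. -/
theorem not_three_vert_collinear {S : Set Pt} {c d : Pt} {w : Fin 3 → Pt} (hw : ∀ i, w i ∈ vert S)
    (hinj : Function.Injective w) {t : Fin 3 → ℝ} (h1 : ∀ i, (w i).1 = c.1 + t i * d.1)
    (h2 : ∀ i, (w i).2 = c.2 + t i * d.2) : False := by
  have key : ∀ i j k, t i < t j → t j < t k → False := by
    intro i j k hij hjk
    have hne : ∀ {i j}, t i ≠ t j → w i ≠ w j := fun h h' => h (congrArg t (hinj h'))
    refine vert_not_combination (hw j) (hw i).1 (hw k).1 (hw k).1 (hne hij.ne) (hne hjk.ne')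
      (hne hjk.ne') (α := t k - t j) (β := t j - t i) (γ := 0) (by linarith) (by linarith) le_rfl
      (by linarith) ?_ ?_
    · rw [h1, h1, h1]; ring
    · rw [h2, h2, h2]; ring
  have hne : ∀ {i j}, i ≠ j → t i ≠ t j := fun {i j} hij h => hij (hinj (Prod.ext
    (by rw [h1, h1, h]) (by rw [h2, h2, h])))
  rcases lt_or_gt_of_ne (hne (show (0 : Fin 3) ≠ 1 by decide)) with h01 | h01 <;>
    rcases lt_or_gt_of_ne (hne (show (0 : Fin 3) ≠ 2 by decide)) with h02 | h02 <;>
    rcases lt_or_gt_of_ne (hne (show (1 : Fin 3) ≠ 2 by decide)) with h12 | h12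
  · exact key _ _ _ h01 h12
  · exact key _ _ _ h02 h12
  · exact lt_asymm (h01.trans h12) h02
  · exact key _ _ _ h02 h01
  · exact key _ _ _ h01 h02
  · exact lt_asymm (h12.trans h01) h02
  · exact key _ _ _ h12 h02
  · exact key _ _ _ h12 h01

theorem centroid_mem_convexHull {Q : Finset Pt} (hQ : Q.Nonempty) :
    centroid Q ∈ convexHull ℝ (Q : Set Pt) := by
  have h : (0 : ℝ) < Q.card := by exact_mod_cast hQ.card_pos
  have key := (convex_convexHull ℝ (Q : Set Pt)).sum_mem (t := Q) (w := fun _ => (Q.card : ℝ)⁻¹)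
    (z := id) (fun _ _ => by positivity) (by simp [h.ne'])
    (fun q hq => subset_convexHull ℝ _ hq)
  convert key using 1
  ext
  · simp [centroid, ← Finset.mul_sum, Prod.fst_sum, div_eq_inv_mul]
  · simp [centroid, ← Finset.mul_sum, Prod.snd_sum, div_eq_inv_mul]

/-- `orient` is affine in its last argument, so the sum is a multiple of the value at the centroid.
-/
theorem sum_orient_centroid (Q : Finset Pt) (x : Pt) (hQ : Q.Nonempty) :
    ∑ q ∈ Q, orient (centroid Q) x q = 0 := by
  have h : (Q.card : ℝ) ≠ 0 := by exact_mod_cast hQ.card_pos.ne'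
  simp only [orient, Finset.sum_sub_distrib, ← Finset.mul_sum, Finset.sum_const, nsmul_eq_mul]
  simp only [centroid, mul_div_cancel₀ _ h]
  simp

/-- If the mean of `Q` were `p`, so would be the mean of the other points, and `p` would lie in
their hull. -/
theorem centroid_ne_of_mem_vert {Q : Finset Pt} {p : Pt} (hp : p ∈ vert (convexHull ℝ (Q : Set Pt)))
    (hpQ : p ∈ Q) (hQ : Q ≠ {p}) : centroid Q ≠ p := by
  classical
  intro h
  have hne : (Q.erase p).Nonempty :=
    (Finset.erase_nonempty hpQ).2 ((Finset.nontrivial_iff_ne_singleton hpQ).2 hQ)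
  have hcard : (Q.card : ℝ) ≠ 0 := by exact_mod_cast (Finset.card_pos.2 ⟨p, hpQ⟩).ne'
  have hcard' : ((Q.erase p).card : ℝ) = Q.card - 1 := by
    rw [Finset.card_erase_of_mem hpQ, Nat.cast_sub (Finset.card_pos.2 ⟨p, hpQ⟩), Nat.cast_one]
  have hcard0 : ((Q.erase p).card : ℝ) ≠ 0 := by exact_mod_cast hne.card_pos.ne'
  have heq : centroid (Q.erase p) = p := by
    have h1 := congrArg Prod.fst h
    have h2 := congrArg Prod.snd h
    simp only [centroid, div_eq_iff hcard] at h1 h2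
    ext
    · simp only [centroid]
      rw [div_eq_iff hcard0, Finset.sum_erase_eq_sub hpQ, h1, hcard']
      ring
    · simp only [centroid]
      rw [div_eq_iff hcard0, Finset.sum_erase_eq_sub hpQ, h2, hcard']
      ring
  refine hp.2 (heq ▸ convexHull_mono ?_ (centroid_mem_convexHull hne))
  intro q hq
  rw [Finset.coe_erase] at hq
  rw [heq]
  exact ⟨subset_convexHull ℝ _ hq.1, hq.2⟩

/-! ### The round trip around the hull. -/

/-- The data of the round trip: the sorted points of `Q` and the indices of the vertices. -/
structure Trip (Q : Finset Pt) {n m : ℕ} (q : Fin n → Pt) (k : Fin m → Fin n) : Prop where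
  sorted : IsSorted (centroid Q) Q q
  scan : IsScan q k
  nonempty : Q.Nonempty
  ne_singleton : ∀ p, Q ≠ {p}

namespace Trip

variable {Q : Finset Pt} {n m : ℕ} {q : Fin n → Pt} {k : Fin m → Fin n}

theorem mem_vert (T : Trip Q q k) (i : Fin m) : q (k i) ∈ vert (convexHull ℝ (Q : Set Pt)) := by
  have : k i ∈ Set.range k := ⟨i, rfl⟩
  rwa [T.scan.2, T.sorted.2.1] at this

theorem mem (T : Trip Q q k) (i : Fin n) : q i ∈ Q := by
  have : q i ∈ Set.range q := ⟨i, rfl⟩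
  rwa [T.sorted.2.1] at this

theorem exists_index (T : Trip Q q k) {x : Pt} (hx : x ∈ Q) : ∃ j, q j = x := by
  have : x ∈ Set.range q := by rwa [T.sorted.2.1]
  exact this

/-- Krein–Milman; no closure is needed, as the hull of finitely many vertices is closed. -/
theorem subset_convexHull_range (T : Trip Q q k) :
    (Q : Set Pt) ⊆ convexHull ℝ (Set.range fun i => q (k i)) := by
  have hrange : (convexHull ℝ (Q : Set Pt)).extremePoints ℝ ⊆ Set.range fun i => q (k i) := by
    intro x hx
    obtain ⟨j, rfl⟩ := T.exists_index (extremePoints_convexHull_subset hx)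
    rw [← vert_eq_extremePoints (convex_convexHull ℝ _), ← T.sorted.2.1] at hx
    have : j ∈ Set.range k := by rw [T.scan.2]; exact hx
    obtain ⟨i, rfl⟩ := this
    exact ⟨i, rfl⟩
  have hKM := closure_convexHull_extremePoints (Q.finite_toSet.isCompact_convexHull ℝ)
    (convex_convexHull ℝ (Q : Set Pt))
  refine (subset_convexHull ℝ _).trans (hKM.symm.subset.trans ?_)
  exact closure_minimal (convexHull_mono hrange)
    ((Set.finite_range _).isClosed_convexHull ℝ)

theorem injective_vertex (T : Trip Q q k) : Function.Injective fun i => q (k i) :=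
  T.sorted.1.comp T.scan.1.injective

theorem centroid_mem (T : Trip Q q k) : centroid Q ∈ convexHull ℝ (Q : Set Pt) :=
  centroid_mem_convexHull T.nonempty

theorem centroid_ne (T : Trip Q q k) (i : Fin m) : centroid Q ≠ q (k i) :=
  centroid_ne_of_mem_vert (T.mem_vert i) (T.mem _) (T.ne_singleton _)

theorem holds_of_vertices (T : Trip Q q k) {f : Ineq} (h : ∀ i, Holds (q (k i)) f)
    {x : Pt} (hx : x ∈ Q) :
    Holds x f :=
  convexHull_min (t := {p | Holds p f}) (Set.range_subset_iff.2 h) (convex_holds f)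
    (T.subset_convexHull_range hx)

/-- Two vertices on one ray from the pivot are impossible: the nearer would lie between the pivot
and the farther. Ties therefore never occur between two vertices. -/
theorem strictMono_theta (T : Trip Q q k) :
    StrictMono fun i => theta (connect (centroid Q) (q (k i))) := by
  intro i j hij
  refine lt_of_le_of_ne (T.sorted.2.2 _ _ (T.scan.1 hij) (T.centroid_ne i).symm
    (T.centroid_ne j).symm) fun h => ?_
  obtain ⟨t, ht, ha, hb⟩ := exists_pos_smul_of_theta_eq (connect_mem_lin (T.centroid_ne i))
    (connect_mem_lin (T.centroid_ne j)) h
  simp only [connect] at ha hb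
  have hne : q (k i) ≠ q (k j) := T.injective_vertex.ne hij.ne
  rcases lt_trichotomy t 1 with h1 | rfl | h1
  · refine vert_not_combination (T.mem_vert j) (T.mem_vert i).1 T.centroid_mem T.centroid_mem hne
      (T.centroid_ne j) (T.centroid_ne j) (α := t) (β := 1 - t) (γ := 0) ht.le (by linarith)
      le_rfl (by linarith) ?_ ?_ <;> linarith
  · exact hne (Prod.ext (by linarith) (by linarith))
  · refine vert_not_combination (T.mem_vert i) (T.mem_vert j).1 T.centroid_mem T.centroid_mem
      hne.symm (T.centroid_ne i) (T.centroid_ne i) (α := 1) (β := t - 1) (γ := 0) zero_le_one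
      (by linarith) le_rfl (by linarith) ?_ ?_ <;> linarith

/-- Otherwise `Q` lies on one side of the line through pivot and vertex. Since the orientations sum
to zero, `Q` lies on that line, which cannot contain three vertices. -/
theorem exists_orient_pos (T : Trip Q q k) (hm : 3 ≤ m) (i : Fin m) :
    ∃ j, 0 < orient (centroid Q) (q (k i)) (q (k j)) := by
  by_contra hcon
  push Not at hcon
  set c := centroid Q with hc
  have hle : ∀ x ∈ Q, orient c (q (k i)) x ≤ 0 := by
    intro x hx
    have := T.holds_of_vertices (f := connect (q (k i)) c) (fun j => ?_) hx
    · rw [holds_connect_iff] at this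
      unfold orient at this ⊢
      linarith
    · rw [holds_connect_iff]
      have := hcon j
      unfold orient at this ⊢
      linarith
  have hzero : ∀ x ∈ Q, orient c (q (k i)) x = 0 :=
    (Finset.sum_eq_zero_iff_of_nonpos hle).1 (sum_orient_centroid Q _ T.nonempty)
  have hd : 0 < ((q (k i)).1 - c.1) ^ 2 + ((q (k i)).2 - c.2) ^ 2 := by
    by_contra h
    refine T.centroid_ne i (Prod.ext ?_ ?_) <;> nlinarith [sq_nonneg ((q (k i)).1 - c.1),
      sq_nonneg ((q (k i)).2 - c.2)]
  obtain ⟨x, y, hxy⟩ : ∃ x y : ℝ, x = (q (k i)).1 - c.1 ∧ y = (q (k i)).2 - c.2 := ⟨_, _, rfl, rfl⟩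
  rw [← hxy.1, ← hxy.2] at hd
  let t : Pt → ℝ := fun p => ((p.1 - c.1) * x + (p.2 - c.2) * y) / (x ^ 2 + y ^ 2)
  have h12 : ∀ p ∈ Q, p.1 = c.1 + t p * x ∧ p.2 = c.2 + t p * y := by
    intro p hp
    have := hzero p hp
    simp only [orient, ← hxy.1, ← hxy.2] at this
    simp only [t]
    constructor
    · field_simp
      linear_combination (-y) * this
    · field_simp
      linear_combination x * this
  let g : Fin 3 → Fin m := Fin.castLE hm
  exact not_three_vert_collinear (c := c) (d := (x, y)) (w := fun l => q (k (g l)))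
    (fun l => T.mem_vert _) (T.injective_vertex.comp (Fin.castLE_injective hm))
    (t := fun l => t (q (k (g l)))) (fun l => (h12 _ (T.mem _)).1) (fun l => (h12 _ (T.mem _)).2)

theorem orient_pos_iff (T : Trip Q q k) (i j : Fin m) :
    0 < orient (centroid Q) (q (k i)) (q (k j)) ↔
    Ahead (theta (connect (centroid Q) (q (k i)))) (theta (connect (centroid Q) (q (k j)))) := by
  rw [← cross_connect, cross_pos_iff (connect_mem_lin (T.centroid_ne i))
    (connect_mem_lin (T.centroid_ne j))]

theorem orient_centroid_pos (T : Trip Q q k) (hm : 3 ≤ m) (i : Fin m) :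
    0 < orient (centroid Q) (q (k i)) (q (k (cyc i 1))) := by
  obtain ⟨j, hj⟩ := T.exists_orient_pos hm i
  rw [T.orient_pos_iff] at hj ⊢
  exact ahead_cyc_one_of_ahead T.strictMono_theta (fun _ => theta_mem _) hj

/-- A point of the hull that is on or beyond the line of an edge is seen from the pivot through
the edge. -/
theorem orient_pos_of_beyond (T : Trip Q q k) (hm : 3 ≤ m) (i : Fin m) {x : Pt}
    (hx : x ∈ convexHull ℝ (Q : Set Pt)) (h1 : x ≠ q (k i)) (h2 : x ≠ q (k (cyc i 1)))
    (h : orient (q (k i)) (q (k (cyc i 1))) x ≤ 0) :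
    0 < orient (centroid Q) (q (k i)) x ∧ 0 < orient (centroid Q) x (q (k (cyc i 1))) := by
  have hD := T.orient_centroid_pos hm i
  have hab : q (k i) ≠ q (k (cyc i 1)) := T.injective_vertex.ne (cyc_one_ne (by omega)).symm
  have va := T.mem_vert i
  have vb := T.mem_vert (cyc i 1)
  have hc := T.centroid_mem
  have hca := T.centroid_ne i
  have hcb := T.centroid_ne (cyc i 1)
  generalize q (k i) = a at *
  generalize q (k (cyc i 1)) = b at *
  generalize centroid Q = c at *
  have hsum : orient a b x = orient c a b - orient c x b - orient c a x := by
    unfold orient; ring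
  constructor
  · by_contra hneg
    -- The weights come from the barycentric coordinates of `x` in the triangle `c a b`, solved for
    -- `a`; the last one equals `-orient a b x`.
    refine vert_not_combination va hx vb.1 hc h1 hab.symm hca (α := orient c a b)
      (β := -orient c a x) (γ := orient c x b + orient c a x - orient c a b) hD.le (by linarith)
      (by linarith) (by linarith) ?_ ?_ <;> unfold orient <;> ring
  · by_contra hneg
    refine vert_not_combination vb hx va.1 hc h2 hab hcb (α := orient c a b)
      (β := -orient c x b) (γ := orient c x b + orient c a x - orient c a b) hD.le (by linarith)
      (by linarith) (by linarith) ?_ ?_ <;> unfold orient <;> ring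

/-- A vertex on or beyond the edge line would have its angle strictly between those of two
consecutive vertices. -/
theorem orient_edge_pos (T : Trip Q q k) (hm : 3 ≤ m) (i j : Fin m) (h1 : j ≠ i)
    (h2 : j ≠ cyc i 1) :
    0 < orient (q (k i)) (q (k (cyc i 1))) (q (k j)) := by
  by_contra hcon
  obtain ⟨h3, h4⟩ := T.orient_pos_of_beyond hm i (T.mem_vert j).1 (T.injective_vertex.ne h1)
    (T.injective_vertex.ne h2) (not_lt.1 hcon)
  have h5 := T.orient_centroid_pos hm i
  rw [T.orient_pos_iff] at h3 h4 h5
  exact not_ahead_between T.strictMono_theta (fun _ => theta_mem _) h5 h3 h4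

theorem holds_edge (T : Trip Q q k) (hm : 3 ≤ m) (i : Fin m) {x : Pt} (hx : x ∈ Q) :
    Holds x (connect (q (k i)) (q (k (cyc i 1)))) := by
  refine T.holds_of_vertices (fun j => ?_) hx
  rw [holds_connect_iff]
  by_cases h1 : j = i
  · rw [h1]; unfold orient; apply le_of_eq; ring
  by_cases h2 : j = cyc i 1
  · rw [h2]; unfold orient; apply le_of_eq; ring
  exact (T.orient_edge_pos hm i j h1 h2).le

/-- A point in the box on the boundary line of an edge causes the edge to be added. -/
theorem add_of_saturates (T : Trip Q q k) (hm : 3 ≤ m) (i : Fin m) {s : ℝ}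
    {x : Pt} (hx : x ∈ Q) (hbox : InBox s x)
    (hsat : Saturates x (connect (q (k i)) (q (k (cyc i 1))))) : Add s q k i := by
  by_cases h1 : x = q (k i)
  · exact .inl (h1 ▸ hbox)
  by_cases h2 : x = q (k (cyc i 1))
  · exact .inr (.inl (h2 ▸ hbox))
  refine .inr (.inr (.inr ?_))
  obtain ⟨h3, h4⟩ := T.orient_pos_of_beyond hm i (subset_convexHull ℝ _ hx) h1 h2
    (saturates_connect_iff.1 hsat).le
  have h5 := T.orient_centroid_pos hm i
  obtain ⟨j, rfl⟩ := T.exists_index hx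
  have hcx : q j ≠ centroid Q := by
    intro h
    rw [h] at h4
    simp [orient] at h4
  have hLx := connect_mem_lin hcx.symm
  have hLa := connect_mem_lin (T.centroid_ne i)
  have hLb := connect_mem_lin (T.centroid_ne (cyc i 1))
  rw [← cross_connect, cross_pos_iff hLa hLx] at h3
  rw [← cross_connect, cross_pos_iff hLx hLb] at h4
  rw [T.orient_pos_iff] at h5
  -- Strict inequality of angles forces the order of indices, however ties and the pivot were
  -- placed.
  have hlt : ∀ {l l' : Fin n}, q l ≠ centroid Q → q l' ≠ centroid Q →
      theta (connect (centroid Q) (q l)) < theta (connect (centroid Q) (q l')) →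
      l.val < l'.val := by
    intro l l' hl hl' h
    by_contra hge
    rcases (not_lt.1 hge).eq_or_lt with heq | hlt
    · rw [Fin.ext heq] at h; exact lt_irrefl _ h
    · exact absurd (T.sorted.2.2 l' l (Fin.lt_def.2 hlt) hl' hl) (not_le.2 h)
  have hca := (T.centroid_ne i).symm
  have hcb := (T.centroid_ne (cyc i 1)).symm
  have hj := j.isLt
  have hi := (k i).isLt
  have hi' := (k (cyc i 1)).isLt
  have hval : ∀ u, u < n → (cyc (k i) u).val =
      if (k i).val + u < n then (k i).val + u else (k i).val + u - n := by
    intro u hu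
    unfold cyc
    split_ifs with h
    · exact Nat.mod_eq_of_lt h
    · dsimp only
      rw [Nat.mod_eq_sub_mod (not_lt.1 h), Nat.mod_eq_of_lt (by omega)]
  obtain ⟨t, ht, htn, htj, hbetween⟩ : ∃ t, 1 ≤ t ∧ t < n ∧ cyc (k i) t = j ∧
      ∀ u, 1 ≤ u → u ≤ t → cyc (k i) u ≠ k (cyc i 1) := by
    have hcase : ((k i).val < j.val ∧ j.val < (k (cyc i 1)).val) ∨
        (j.val < (k (cyc i 1)).val ∧ (k (cyc i 1)).val < (k i).val) ∨
        ((k (cyc i 1)).val < (k i).val ∧ (k i).val < j.val) := by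
      rcases h3.cyclic_order (theta_mem _).2 (theta_mem _).1 h4 h5 with
        ⟨h6, h7⟩ | ⟨h6, h7⟩ | ⟨h6, h7⟩
      · exact .inl ⟨hlt hca hcx h6, hlt hcx hcb h7⟩
      · exact .inr (.inl ⟨hlt hcx hcb h6, hlt hcb hca h7⟩)
      · exact .inr (.inr ⟨hlt hcb hca h6, hlt hca hcx h7⟩)
    refine ⟨if (k i).val < j.val then j.val - (k i).val else j.val + n - (k i).val, ?_, ?_, ?_, ?_⟩
    · split_ifs <;> omega
    · split_ifs <;> omega
    · ext
      rw [hval _ (by split_ifs <;> omega)]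
      split_ifs <;> omega
    · intro u hu hut heq
      have := congrArg Fin.val heq
      rw [hval u (by split_ifs at hut <;> omega)] at this
      split_ifs at this hut <;> omega
  subst htj
  exact ⟨t, ht, hbetween, hsat, hbox⟩

end Trip

/-! ### Non-redundancy by perturbation, and the box. -/

/-- An inequality is not redundant if one can leave its half-plane from a boundary point without
violating the other inequalities. -/
theorem sol_diff_ne_of_perturbation {E : Set Ineq} (hfin : E.Finite) {e : Ineq} (he : e ∈ E)
    {p d : Pt} (hp : dot e p = e.c) (hd : 0 < dot e d)
    (h : ∀ e' ∈ E, e' ≠ e → dot e' p < e'.c ∨ (dot e' p ≤ e'.c ∧ dot e' d ≤ 0)) :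
    sol (E \ {e}) ≠ sol E := by
  have hev : ∀ e' ∈ E, ∀ᶠ t in nhdsWithin (0 : ℝ) (Set.Ioi 0), e' ≠ e → Holds (p + t • d) e' := by
    intro e' he'
    by_cases hne : e' = e
    · exact .of_forall fun t h => absurd hne h
    have hcont : Filter.Tendsto (fun t : ℝ => dot e' p + t * dot e' d)
        (nhdsWithin (0 : ℝ) (Set.Ioi 0)) (nhds (dot e' p)) := by
      have : Continuous fun t : ℝ => dot e' p + t * dot e' d := by fun_prop
      simpa using (this.tendsto 0).mono_left nhdsWithin_le_nhds
    rcases h e' he' hne with h1 | ⟨h1, h2⟩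
    · filter_upwards [hcont.eventually_lt_const h1] with t ht _
      rw [holds_iff, map_add, map_smul, smul_eq_mul]
      exact ht.le
    · filter_upwards [self_mem_nhdsWithin] with t ht _
      rw [holds_iff, map_add, map_smul, smul_eq_mul]
      linarith [mul_nonpos_of_nonneg_of_nonpos (le_of_lt ht) h2]
  obtain ⟨t, ht, ht0⟩ := (((Filter.eventually_all_finite hfin).2 hev).and
    self_mem_nhdsWithin).exists
  intro heq
  have hmem : p + t • d ∈ sol (E \ {e}) := fun e' he' => ht e' he'.1 he'.2
  rw [heq] at hmem
  have := (holds_iff _ _).1 (hmem e he)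
  rw [map_add, map_smul, smul_eq_mul, hp] at this
  linarith [mul_pos ht0 hd]

/-- The points and rays of a reconstruction together with the size of the box. -/
structure BoxData (P R : Finset Pt) (s : ℝ) : Prop where
  nonempty : P.Nonempty
  pos : 0 < s
  inBox : ∀ p ∈ P, InBox s p
  norm : ∀ r ∈ R, r.1 ^ 2 + r.2 ^ 2 = 1

namespace BoxData

variable {P R : Finset Pt} {s : ℝ}

theorem mem_boxedPoints {x : Pt} : x ∈ boxedPoints P R s ↔
    x ∈ P ∨ ∃ p ∈ P, ∃ r ∈ R, x = p + (2 * √2 * s) • r := by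
  simp only [boxedPoints, Finset.mem_union, Finset.mem_image, Finset.mem_product]
  refine or_congr_right ⟨?_, ?_⟩
  · rintro ⟨⟨p, r⟩, ⟨hp, hr⟩, rfl⟩
    exact ⟨p, hp, r, hr, rfl⟩
  · rintro ⟨p, hp, r, hr, rfl⟩
    exact ⟨(p, r), ⟨hp, hr⟩, rfl⟩

theorem scale_pos (B : BoxData P R s) : 0 < 2 * √2 * s := by have := B.pos; positivity

/-- The translation has length `2√2 s`, the diagonal of the box, whereas two points of the open box
are closer than that. -/
theorem not_inBox (B : BoxData P R s) {p r : Pt} (hp : p ∈ P) (hr : r ∈ R) :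
    ¬ InBox s (p + (2 * √2 * s) • r) := by
  rintro ⟨h1, h2⟩
  obtain ⟨h3, h4⟩ := B.inBox p hp
  have hn := B.norm r hr
  have hs := B.pos
  simp only [Prod.fst_add, Prod.snd_add, Prod.smul_fst, Prod.smul_snd, smul_eq_mul] at h1 h2
  rw [abs_lt] at h1 h2 h3 h4
  have h5 : (2 * √2 * s * r.1) ^ 2 < (2 * s) ^ 2 := by
    apply sq_lt_sq'
    · linarith
    · linarith
  have h6 : (2 * √2 * s * r.2) ^ 2 < (2 * s) ^ 2 := by
    apply sq_lt_sq'
    · linarith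
    · linarith
  have h7 : (2 * √2 * s * r.1) ^ 2 + (2 * √2 * s * r.2) ^ 2 = 8 * s ^ 2 := by
    have h2 : √2 ^ 2 = 2 := Real.sq_sqrt (by norm_num)
    linear_combination (4 * √2 ^ 2 * s ^ 2) * hn + 4 * s ^ 2 * h2
  nlinarith

theorem mem_of_inBox (B : BoxData P R s) {x : Pt} (hx : x ∈ boxedPoints P R s)
    (hbox : InBox s x) : x ∈ P := by
  rcases mem_boxedPoints.1 hx with h | ⟨p, hp, r, hr, rfl⟩
  · exact h
  · exact absurd hbox (B.not_inBox hp hr)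

/-- An inequality that holds on `Q` and has a boundary point in the box is valid on the points
and rays. -/
theorem validOn (B : BoxData P R s) {f : Ineq} (h : ∀ x ∈ boxedPoints P R s, Holds x f) {x : Pt}
    (hx : x ∈ boxedPoints P R s) (hbox : InBox s x) (hsat : Saturates x f) : ValidOn P R f := by
  refine ⟨fun p hp => h p (mem_boxedPoints.2 (.inl hp)), fun r hr => ?_⟩
  have h1 := (holds_iff _ _).1
    (h _ (mem_boxedPoints.2 (.inr ⟨x, B.mem_of_inBox hx hbox, r, hr, rfl⟩)))
  rw [saturates_iff] at hsat
  rw [map_add, map_smul, smul_eq_mul, hsat] at h1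
  by_contra hcon
  linarith [mul_pos B.scale_pos (not_le.1 hcon)]

/-- Translating along rays cannot increase the functional, so its maximum over `Q` is attained
inside the box. -/
theorem exists_max (B : BoxData P R s) (f : Ineq) (hf : ∀ r ∈ R, dot f r ≤ 0) :
    ∃ p ∈ P, ∀ x ∈ boxedPoints P R s, dot f x ≤ dot f p := by
  obtain ⟨p, hp, hmax⟩ := P.exists_max_image (dot f) B.nonempty
  refine ⟨p, hp, fun x hx => ?_⟩
  rcases mem_boxedPoints.1 hx with h | ⟨p', hp', r, hr, rfl⟩
  · exact hmax x h
  · rw [map_add, map_smul, smul_eq_mul]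
    linarith [hmax p' hp', mul_nonpos_of_nonneg_of_nonpos B.scale_pos.le (hf r hr)]

end BoxData

/-! ### From points and rays back to inequalities. -/

/-- What is to be proved about the result of the reconstruction. -/
structure Describes (P R : Finset Pt) (E : Set Ineq) : Prop where
  finite : E.Finite
  lin : E ⊆ Lin
  nonRedundant : NonRedundant E
  valid : ∀ e ∈ E, ValidOn P R e
  complete : ∀ f, ValidOn P R f → ∀ x ∈ sol E, Holds x f

theorem describes_point {P R : Finset Pt} {s : ℝ} (B : BoxData P R s) {p : Pt}
    (h : boxedPoints P R s = {p}) : Describes P R (pointIneqs p) := by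
  have hP : ∀ x ∈ P, x = p := fun x hx => by
    have : x ∈ boxedPoints P R s := BoxData.mem_boxedPoints.2 (.inl hx)
    simpa [h] using this
  have hpP : p ∈ P := by
    obtain ⟨x, hx⟩ := B.nonempty
    exact hP x hx ▸ hx
  have hR : ∀ r, r ∉ R := by
    intro r hr
    have h1 : p + (2 * √2 * s) • r = p := by
      have : p + (2 * √2 * s) • r ∈ boxedPoints P R s :=
        BoxData.mem_boxedPoints.2 (.inr ⟨p, hpP, r, hr, rfl⟩)
      simpa [h] using this
    rw [add_eq_left, smul_eq_zero_iff_right B.scale_pos.ne'] at h1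
    have := B.norm r hr
    simp [h1] at this
  have hfin : (pointIneqs p).Finite := by simp [pointIneqs]
  refine ⟨hfin, ?_, ?_, ?_, ?_⟩
  · rintro e (rfl | rfl | rfl | rfl) <;> simp [Lin]
  · intro e he
    refine sol_diff_ne_of_perturbation hfin he (p := p) (d := (e.a, e.b)) ?_ ?_ ?_
    · rcases he with (rfl | rfl | rfl | rfl) <;> simp
    · rcases he with (rfl | rfl | rfl | rfl) <;> simp
    · intro e' he' hne
      right
      rcases he with (rfl | rfl | rfl | rfl) <;> rcases he' with (rfl | rfl | rfl | rfl) <;>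
        first | exact absurd rfl hne | simp
  · intro e he
    refine ⟨fun x hx => ?_, fun r hr => absurd hr (hR r)⟩
    rw [hP x hx]
    rcases he with (rfl | rfl | rfl | rfl) <;> simp [Holds]
  · intro f hf x hx
    have h1 := hx ⟨1, 0, p.1⟩ (by simp [pointIneqs])
    have h2 := hx ⟨0, 1, p.2⟩ (by simp [pointIneqs])
    have h3 := hx ⟨-1, 0, -p.1⟩ (by simp [pointIneqs])
    have h4 := hx ⟨0, -1, -p.2⟩ (by simp [pointIneqs])
    simp only [Holds] at h1 h2 h3 h4
    have : x = p := Prod.ext (by linarith) (by linarith)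
    exact this ▸ hf.1 p hpP

theorem finite_roundTrip {n m : ℕ} (s : ℝ) (q : Fin n → Pt) (k : Fin m → Fin n) :
    (roundTrip s q k).Finite := by
  unfold roundTrip
  rw [Set.ofPred_exists]
  refine Set.finite_iUnion fun i => (Set.toFinite {cap (q (k i)) (q (k (cyc i 1))),
    connect (q (k i)) (q (k (cyc i 1)))}).subset ?_
  rintro e (⟨-, -, h⟩ | ⟨-, h⟩) <;> simp [h]

theorem orient_self_left (x y : Pt) : orient x y x = 0 := by unfold orient; ring

theorem orient_self_right (x y : Pt) : orient x y y = 0 := by unfold orient; ring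

theorem dot_connect (x y z : Pt) : dot (connect x y) z = (connect x y).c - orient x y z := by
  simp only [dot_apply, connect, orient]; ring

/-- The reconstruction if the hull of the points has at least three vertices. -/
theorem describes_roundTrip_of_three_le {P R : Finset Pt} {s : ℝ} (B : BoxData P R s) {n m : ℕ}
    {q : Fin n → Pt} {k : Fin m → Fin n} (T : Trip (boxedPoints P R s) q k) (hm : 3 ≤ m) :
    Describes P R (roundTrip s q k) := by
  have hm2 : m ≠ 2 := by omega
  have hmem : ∀ e, e ∈ roundTrip s q k ↔
      ∃ i, Add s q k i ∧ e = connect (q (k i)) (q (k (cyc i 1))) := by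
    intro e
    simp [roundTrip, hm2]
  have hfin := finite_roundTrip s q k
  have hne : ∀ i, q (k i) ≠ q (k (cyc i 1)) := fun i =>
    T.injective_vertex.ne (cyc_one_ne (by omega)).symm
  refine ⟨hfin, ?_, ?_, ?_, ?_⟩
  · intro e he
    obtain ⟨i, -, rfl⟩ := (hmem e).1 he
    exact connect_mem_lin (hne i)
  · intro e he
    obtain ⟨i, -, rfl⟩ := (hmem e).1 he
    set a := q (k i) with ha
    set b := q (k (cyc i 1)) with hb
    -- The midpoint of an edge is strictly inside every other edge inequality, since another edge
    -- misses at least one of the two end points.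
    refine sol_diff_ne_of_perturbation hfin he (p := ((a.1 + b.1) / 2, (a.2 + b.2) / 2))
      (d := ((connect a b).a, (connect a b).b)) ?_ ?_ ?_
    · rw [dot_connect, sub_eq_self]
      unfold orient; ring
    · have := connect_mem_lin (hne i)
      rw [dot_apply, ← sq, ← sq]
      rcases this with h | h <;> positivity
    · intro e' he' hee
      obtain ⟨j, -, rfl⟩ := (hmem e').1 he'
      left
      have hij : j ≠ i := fun h => hee (by rw [h])
      rw [dot_connect, sub_lt_self_iff]
      have hmid : orient (q (k j)) (q (k (cyc j 1))) ((a.1 + b.1) / 2, (a.2 + b.2) / 2) =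
          (orient (q (k j)) (q (k (cyc j 1))) a + orient (q (k j)) (q (k (cyc j 1))) b) / 2 := by
        unfold orient; ring
      have h1 := holds_connect_iff.1 (T.holds_edge hm j (T.mem (k i)))
      have h2 := holds_connect_iff.1 (T.holds_edge hm j (T.mem (k (cyc i 1))))
      rw [hmid]
      by_cases hi1 : i = cyc j 1
      · have h3 := T.orient_edge_pos hm j (cyc i 1) (fun h => ?_) (fun h => ?_)
        · linarith
        · rw [hi1] at h
          have := congrArg Fin.val h
          have := j.isLt
          rcases cyc_one_val j with h4 | h4 <;> rcases cyc_one_val (cyc j 1) with h5 | h5 <;> omega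
        · exact cyc_one_ne (by omega) (h.trans hi1.symm)
      · have h3 := T.orient_edge_pos hm j i hij.symm hi1
        linarith
  · intro e he
    obtain ⟨i, hadd, rfl⟩ := (hmem e).1 he
    have hQ : ∀ x ∈ boxedPoints P R s, Holds x (connect (q (k i)) (q (k (cyc i 1)))) :=
      fun x hx => T.holds_edge hm i hx
    rcases hadd with h | h | h | ⟨t, -, -, hs, h⟩
    · exact B.validOn hQ (T.mem _) h (saturates_connect_iff.2 (orient_self_left _ _))
    · exact B.validOn hQ (T.mem _) h (saturates_connect_iff.2 (orient_self_right _ _))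
    · exact absurd h hm2
    · exact B.validOn hQ (T.mem _) h hs
  · intro f hf x hx
    obtain ⟨p, hpP, hmax⟩ := B.exists_max f hf.2
    have hpQ : p ∈ boxedPoints P R s := BoxData.mem_boxedPoints.2 (.inl hpP)
    have : Nonempty (Fin m) := ⟨⟨0, by omega⟩⟩
    obtain ⟨l, hl⟩ := Finite.exists_max fun i => dot f (q (k i))
    obtain ⟨i, rfl⟩ : ∃ i, cyc i 1 = l := ⟨_, cyc_sub_one_cyc_one l⟩
    have hpv : dot f p = dot f (q (k (cyc i 1))) :=
      le_antisymm ((holds_iff _ ⟨f.a, f.b, dot f (q (k (cyc i 1)))⟩).1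
        (T.holds_of_vertices (f := ⟨f.a, f.b, dot f (q (k (cyc i 1)))⟩)
          (fun j => (holds_iff _ _).2 (hl j)) hpQ)) (hmax _ (T.mem _))
    have hD := T.orient_edge_pos hm i (cyc (cyc i 1) 1) (fun h => by
      have := congrArg Fin.val h
      have := i.isLt
      rcases cyc_one_val i with h4 | h4 <;> rcases cyc_one_val (cyc i 1) with h5 | h5 <;> omega)
      (cyc_one_ne (by omega))
    have hα : 0 ≤ dot f (q (k (cyc i 1))) - dot f (q (k (cyc (cyc i 1) 1))) := sub_nonneg.2 (hl _)
    have hβ : 0 ≤ dot f (q (k (cyc i 1))) - dot f (q (k i)) := sub_nonneg.2 (hl _)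
    have hp1 := holds_connect_iff.1 (T.holds_edge hm i hpQ)
    have hp2 := holds_connect_iff.1 (T.holds_edge hm (cyc i 1) hpQ)
    have hA1 : orient (q (k i)) (q (k (cyc i 1))) p = 0 →
        0 ≤ orient (q (k i)) (q (k (cyc i 1))) x := fun h =>
      holds_connect_iff.1 (hx _ ((hmem _).2 ⟨i, T.add_of_saturates hm i hpQ (B.inBox p hpP)
        (saturates_connect_iff.2 h), rfl⟩))
    have hA2 : orient (q (k (cyc i 1))) (q (k (cyc (cyc i 1) 1))) p = 0 →
        0 ≤ orient (q (k (cyc i 1))) (q (k (cyc (cyc i 1) 1))) x := fun h =>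
      holds_connect_iff.1 (hx _ ((hmem _).2 ⟨_, T.add_of_saturates hm _ hpQ (B.inBox p hpP)
        (saturates_connect_iff.2 h), rfl⟩))
    have hpf := (holds_iff _ _).1 (hf.1 p hpP)
    generalize q (k i) = a at *
    generalize q (k (cyc (cyc i 1) 1)) = d at *
    generalize q (k (cyc i 1)) = b at *
    -- At the maximal vertex `b`, the slack of `f` is a nonnegative combination of the slacks of the
    -- two adjacent edges. At `p` it vanishes, so each edge has coefficient zero or passes through
    -- `p` and was emitted.
    have key : ∀ z, orient a b d * (dot f b - dot f z) =
        (dot f b - dot f d) * orient a b z + (dot f b - dot f a) * orient b d z := by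
      intro z
      simp only [dot_apply, orient]; ring
    have kp := key p
    rw [hpv, sub_self, mul_zero] at kp
    have k1 := mul_nonneg hα hp1
    have k2 := mul_nonneg hβ hp2
    have k1' : 0 ≤ (dot f b - dot f d) * orient a b x := by
      rcases mul_eq_zero.1 (show (dot f b - dot f d) * orient a b p = 0 by linarith) with h | h
      · rw [h, zero_mul]
      · exact mul_nonneg hα (hA1 h)
    have k2' : 0 ≤ (dot f b - dot f a) * orient b d x := by
      rcases mul_eq_zero.1 (show (dot f b - dot f a) * orient b d p = 0 by linarith) with h | h
      · rw [h, zero_mul]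
      · exact mul_nonneg hβ (hA2 h)
    have kx := key x
    have : 0 ≤ dot f b - dot f x := by
      by_contra hcon
      have := mul_neg_of_pos_of_neg hD (not_le.1 hcon)
      linarith
    rw [holds_iff]
    linarith

theorem dot_cap_self (u v : Pt) : dot (cap u v) u = (cap u v).c := by
  unfold cap; split_ifs <;> simp

theorem sign_mul_self_pos {t : ℝ} (h : t ≠ 0) : 0 < Real.sign t * t := by
  rcases lt_or_gt_of_ne h with h | h
  · rw [Real.sign_of_neg h]; linarith
  · rw [Real.sign_of_pos h]; linarith

theorem dot_cap_lt {u v : Pt} (h : u ≠ v) : dot (cap u v) v < (cap u v).c := by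
  unfold cap
  split_ifs with h2
  · have := sign_mul_self_pos (sub_ne_zero.2 fun h1 => h (Prod.ext h1 h2))
    simp only [dot_apply]
    linarith
  · have := sign_mul_self_pos (sub_ne_zero.2 h2)
    simp only [dot_apply]
    linarith

theorem cap_mem_lin {u v : Pt} (h : u ≠ v) : cap u v ∈ Lin := by
  by_contra hcon
  simp only [Lin, Set.mem_ofPred_eq, not_or, not_not] at hcon
  have h1 := dot_cap_lt h
  rw [← dot_cap_self] at h1
  simp [hcon.1, hcon.2] at h1

theorem dot_midpoint (f : Ineq) (u v : Pt) :
    dot f ((u.1 + v.1) / 2, (u.2 + v.2) / 2) = (dot f u + dot f v) / 2 := by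
  simp only [dot_apply]; ring

/-- A linear functional on a line is determined by its values at two points. -/
theorem dot_sub_of_orient_eq_zero {u v x : Pt} (h : orient u v x = 0) (f : Ineq) :
    ((v.1 - u.1) ^ 2 + (v.2 - u.2) ^ 2) * (dot f x - dot f u) =
      ((x.1 - u.1) * (v.1 - u.1) + (x.2 - u.2) * (v.2 - u.2)) * (dot f v - dot f u) := by
  unfold orient at h
  simp only [dot_apply]
  linear_combination (f.b * (v.1 - u.1) - f.a * (v.2 - u.2)) * h

theorem Trip.two_le {Q : Finset Pt} {n m : ℕ} {q : Fin n → Pt} {k : Fin m → Fin n}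
    (T : Trip Q q k) : 2 ≤ m := by
  obtain ⟨x, hx⟩ := T.nonempty
  have hsub := T.subset_convexHull_range
  by_contra hm
  obtain rfl | rfl : m = 0 ∨ m = 1 := by omega
  · have := hsub hx
    simp at this
  · refine T.ne_singleton (q (k 0)) (Finset.eq_singleton_iff_unique_mem.2 ⟨T.mem _, fun y hy => ?_⟩)
    have := hsub hy
    rwa [Set.range_unique, convexHull_singleton] at this

/-- The reconstruction if the hull of the points is a segment. -/
theorem describes_roundTrip_of_eq_two {P R : Finset Pt} {s : ℝ} (B : BoxData P R s) {n : ℕ}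
    {q : Fin n → Pt} {k : Fin 2 → Fin n} (T : Trip (boxedPoints P R s) q k) :
    Describes P R (roundTrip s q k) := by
  have hmem : ∀ e, e ∈ roundTrip s q k ↔
      ∃ i, (InBox s (q (k i)) ∧ e = cap (q (k i)) (q (k (cyc i 1)))) ∨
        e = connect (q (k i)) (q (k (cyc i 1))) := by
    intro e
    simp [roundTrip, Add]
  have hfin := finite_roundTrip s q k
  have hcyc : ∀ i : Fin 2, cyc (cyc i 1) 1 = i := by decide
  have hcases : ∀ i j : Fin 2, j = i ∨ j = cyc i 1 := by decide
  have hne : ∀ i, q (k i) ≠ q (k (cyc i 1)) := fun i =>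
    T.injective_vertex.ne (cyc_one_ne (by omega)).symm
  have hline : ∀ i, ∀ x ∈ boxedPoints P R s,
      Holds x (connect (q (k i)) (q (k (cyc i 1)))) := by
    intro i x hx
    refine T.holds_of_vertices (fun j => ?_) hx
    rw [holds_connect_iff]
    rcases hcases i j with rfl | rfl
    · exact (orient_self_left _ _).ge
    · exact (orient_self_right _ _).ge
  have hswap : ∀ u v x : Pt, orient v u x = -orient u v x := fun u v x => by
    unfold orient; ring
  have hcol : ∀ x, (∀ i, Holds x (connect (q (k i)) (q (k (cyc i 1))))) → ∀ i,
      orient (q (k i)) (q (k (cyc i 1))) x = 0 := by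
    intro x hx i
    have h1 := holds_connect_iff.1 (hx i)
    have h2 := holds_connect_iff.1 (hx (cyc i 1))
    rw [hcyc, hswap] at h2
    linarith
  have hvcap : ∀ i, ∀ x ∈ boxedPoints P R s, Holds x (cap (q (k i)) (q (k (cyc i 1)))) := by
    intro i x hx
    refine T.holds_of_vertices (fun j => ?_) hx
    rw [holds_iff]
    rcases hcases i j with rfl | rfl
    · exact (dot_cap_self _ _).le
    · exact (dot_cap_lt (hne i)).le
  refine ⟨hfin, ?_, ?_, ?_, ?_⟩
  · intro e he
    obtain ⟨i, ⟨-, rfl⟩ | rfl⟩ := (hmem e).1 he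
    · exact cap_mem_lin (hne i)
    · exact connect_mem_lin (hne i)
  · intro e he
    obtain ⟨i, ⟨-, rfl⟩ | rfl⟩ := (hmem e).1 he
    -- A cap is left along the line beyond its end point; a line inequality is left perpendicularly
    -- at the midpoint of the segment.
    · refine sol_diff_ne_of_perturbation hfin he (p := q (k i))
        (d := q (k i) - q (k (cyc i 1))) (dot_cap_self _ _) ?_ ?_
      · rw [map_sub, dot_cap_self, sub_pos]
        exact dot_cap_lt (hne i)
      · intro e' he' hee
        obtain ⟨j, ⟨-, rfl⟩ | rfl⟩ := (hmem e').1 he'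
        · left
          rcases hcases i j with rfl | rfl
          · exact absurd rfl hee
          · rw [hcyc]
            exact dot_cap_lt (hne i).symm
        · right
          rw [map_sub]
          simp only [dot_connect]
          rcases hcases i j with rfl | rfl <;>
            simp [hcyc, orient_self_left, orient_self_right]
    · refine sol_diff_ne_of_perturbation hfin he
        (p := (((q (k i)).1 + (q (k (cyc i 1))).1) / 2, ((q (k i)).2 + (q (k (cyc i 1))).2) / 2))
        (d := ((connect (q (k i)) (q (k (cyc i 1)))).a, (connect (q (k i)) (q (k (cyc i 1)))).b))
        ?_ ?_ ?_
      · simp only [dot_midpoint, dot_connect, orient_self_left, orient_self_right]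
        ring
      · rw [dot_apply, ← sq, ← sq]
        rcases connect_mem_lin (hne i) with h | h <;> positivity
      · intro e' he' hee
        rw [dot_midpoint]
        obtain ⟨j, ⟨-, rfl⟩ | rfl⟩ := (hmem e').1 he'
        · left
          rcases hcases i j with rfl | rfl
          · have := dot_cap_lt (hne j)
            rw [dot_cap_self]
            linarith
          · have := dot_cap_lt (hne i).symm
            rw [hcyc, dot_cap_self]
            linarith
        · right
          rcases hcases i j with rfl | rfl
          · exact absurd rfl hee
          · rw [hcyc]
            refine ⟨by simp only [dot_connect, orient_self_left, orient_self_right]; linarith, ?_⟩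
            simp only [dot_apply, connect]
            nlinarith [sq_nonneg ((q (k i)).1 - (q (k (cyc i 1))).1),
              sq_nonneg ((q (k i)).2 - (q (k (cyc i 1))).2)]
  · intro e he
    obtain ⟨i, ⟨hbox, rfl⟩ | rfl⟩ := (hmem e).1 he
    · exact B.validOn (hvcap i) (T.mem _) hbox ((saturates_iff _ _).2 (dot_cap_self _ _))
    · obtain ⟨p, hp⟩ := B.nonempty
      have hpQ : p ∈ boxedPoints P R s := BoxData.mem_boxedPoints.2 (.inl hp)
      exact B.validOn (hline i) hpQ (B.inBox p hp)
        (saturates_connect_iff.2 (hcol p (fun i => hline i p hpQ) i))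
  · intro f hf x hx
    obtain ⟨p, hpP, hmax⟩ := B.exists_max f hf.2
    have hpQ : p ∈ boxedPoints P R s := BoxData.mem_boxedPoints.2 (.inl hpP)
    obtain ⟨i, hl⟩ := Finite.exists_max fun i => dot f (q (k i))
    have hpv : dot f p = dot f (q (k i)) :=
      le_antisymm ((holds_iff _ ⟨f.a, f.b, dot f (q (k i))⟩).1
        (T.holds_of_vertices (f := ⟨f.a, f.b, dot f (q (k i))⟩)
          (fun j => (holds_iff _ _).2 (hl j)) hpQ)) (hmax _ (T.mem _))
    have hpf := (holds_iff _ _).1 (hf.1 p hpP)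
    have hcolx := hcol x (fun j => hx _ ((hmem _).2 ⟨j, .inr rfl⟩)) i
    have hcolp := hcol p (fun j => hline j p hpQ) i
    have hcap : InBox s (q (k i)) → Holds x (cap (q (k i)) (q (k (cyc i 1)))) := fun h =>
      hx _ ((hmem _).2 ⟨i, .inl ⟨h, rfl⟩⟩)
    have hle := hl (cyc i 1)
    have huv := hne i
    have hcl := dot_cap_lt huv
    have hcs := dot_cap_self (q (k i)) (q (k (cyc i 1)))
    generalize q (k i) = u at *
    generalize q (k (cyc i 1)) = v at *
    have hN : 0 < (v.1 - u.1) ^ 2 + (v.2 - u.2) ^ 2 := by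
      by_contra h
      exact huv (Prod.ext (by nlinarith [sq_nonneg (v.1 - u.1), sq_nonneg (v.2 - u.2)])
        (by nlinarith [sq_nonneg (v.1 - u.1), sq_nonneg (v.2 - u.2)]))
    have hfx := dot_sub_of_orient_eq_zero hcolx f
    rw [holds_iff]
    suffices dot f x - dot f u ≤ 0 by linarith
    refine nonpos_of_mul_nonpos_right (le_of_eq_of_le hfx ?_) hN
    rcases hle.eq_or_lt with heq | hlt
    · rw [heq, sub_self, mul_zero]
    -- If `f` is not constant on the line, its maximum on the segment is attained only at `u`. Thus
    -- `u = p` is in the box and its cap was emitted.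
    · have hpu : p = u := by
        have hfp := dot_sub_of_orient_eq_zero hcolp f
        rw [hpv, sub_self, mul_zero] at hfp
        have h0 := (mul_eq_zero.1 hfp.symm).resolve_right (sub_ne_zero.2 hlt.ne)
        have h1 := dot_sub_of_orient_eq_zero hcolp ⟨1, 0, 0⟩
        have h2 := dot_sub_of_orient_eq_zero hcolp ⟨0, 1, 0⟩
        rw [h0, zero_mul] at h1 h2
        have h1' := (mul_eq_zero.1 h1).resolve_left hN.ne'
        have h2' := (mul_eq_zero.1 h2).resolve_left hN.ne'
        simp only [dot_apply] at h1' h2'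
        exact Prod.ext (by linarith) (by linarith)
      have hc := (holds_iff _ _).1 (hcap (hpu ▸ B.inBox p hpP))
      have hcx := dot_sub_of_orient_eq_zero hcolx (cap u v)
      refine mul_nonpos_of_nonneg_of_nonpos ?_ (by linarith)
      by_contra hneg
      have h1 := mul_pos_of_neg_of_neg (not_le.1 hneg) (by linarith : dot (cap u v) v -
        dot (cap u v) u < 0)
      have h2 := mul_nonpos_of_nonneg_of_nonpos hN.le
        (by linarith : dot (cap u v) x - dot (cap u v) u ≤ 0)
      linarith

theorem boxData_of_isGreatest {P R : Finset Pt} {M : ℝ}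
    (hM : IsGreatest {t | ∃ p ∈ P, t = |p.1| ∨ t = |p.2|} M)
    (hR : ∀ r ∈ R, r.1 ^ 2 + r.2 ^ 2 = 1) : BoxData P R (M + 1) := by
  obtain ⟨⟨p, hp, h⟩, hub⟩ := hM
  have h0 : 0 ≤ M := by rcases h with rfl | rfl <;> exact abs_nonneg _
  refine ⟨⟨p, hp⟩, by linarith, fun x hx => ⟨?_, ?_⟩, hR⟩
  · have := hub ⟨x, hx, .inl rfl⟩
    linarith
  · have := hub ⟨x, hx, .inr rfl⟩
    linarith

theorem boxedPoints_nonempty {P R : Finset Pt} {s : ℝ} (hP : P.Nonempty) :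
    (boxedPoints P R s).Nonempty :=
  hP.mono fun _ hx => BoxData.mem_boxedPoints.2 (.inl hx)

theorem IsReconstruction.describes {P R : Finset Pt} {E : Set Ineq}
    (h : IsReconstruction P R E) (hR : ∀ r ∈ R, r.1 ^ 2 + r.2 ^ 2 = 1) : Describes P R E := by
  obtain ⟨M, s, hM, rfl, ⟨p, hp, rfl⟩ | ⟨hne, n, m, q, k, hq, hk, rfl⟩⟩ := h
  · exact describes_point (boxData_of_isGreatest hM hR) hp
  · have B := boxData_of_isGreatest hM hR
    have T : Trip (boxedPoints P R (M + 1)) q k :=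
      ⟨hq, hk, boxedPoints_nonempty B.nonempty, hne⟩
    rcases T.two_le.eq_or_lt with h | h
    · subst h
      exact describes_roundTrip_of_eq_two B T
    · exact describes_roundTrip_of_three_le B T h

/-! ### Existence of a run, and the conclusion. -/

theorem exists_isSorted (c : Pt) (Q : Finset Pt) :
    ∃ (n : ℕ) (q : Fin n → Pt), IsSorted c Q q := by
  let g : Fin Q.card → Pt := fun i => Q.equivFin.symm i
  have hg : Function.Injective g := Subtype.val_injective.comp Q.equivFin.symm.injective
  have hr : Set.range g = (Q : Set Pt) := by
    ext x
    constructor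
    · rintro ⟨i, rfl⟩
      exact (Q.equivFin.symm i).2
    · intro hx
      exact ⟨Q.equivFin ⟨x, hx⟩, by simp [g]⟩
  let σ := Tuple.sort fun i => theta (connect c (g i))
  refine ⟨_, g ∘ σ, hg.comp σ.injective, ?_, fun i j hij _ _ => ?_⟩
  · rw [σ.surjective.range_comp, hr]
  · exact Tuple.monotone_sort (fun i => theta (connect c (g i))) hij.le

theorem exists_isScan {n : ℕ} (q : Fin n → Pt) : ∃ (m : ℕ) (k : Fin m → Fin n), IsScan q k := by
  classical
  refine ⟨_, (Finset.univ.filter fun i => q i ∈ vert (convexHull ℝ (Set.range q))).orderEmbOfFin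
    rfl, OrderEmbedding.strictMono _, ?_⟩
  rw [Finset.range_orderEmbOfFin]
  ext
  simp

theorem exists_isReconstruction {P : Finset Pt} (hP : P.Nonempty) (R : Finset Pt) :
    ∃ E, IsReconstruction P R E := by
  obtain ⟨p, hp, hmax⟩ := P.exists_max_image (fun p => max |p.1| |p.2|) hP
  have hM : IsGreatest {t | ∃ p ∈ P, t = |p.1| ∨ t = |p.2|} (max |p.1| |p.2|) := by
    refine ⟨⟨p, hp, max_choice _ _⟩, ?_⟩
    rintro t ⟨x, hx, rfl | rfl⟩
    · exact (le_max_left _ _).trans (hmax x hx)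
    · exact (le_max_right _ _).trans (hmax x hx)
  by_cases h : ∃ x, boxedPoints P R (max |p.1| |p.2| + 1) = {x}
  · obtain ⟨x, hx⟩ := h
    exact ⟨_, _, _, hM, rfl, .inl ⟨x, hx, rfl⟩⟩
  · push Not at h
    obtain ⟨n, q, hq⟩ := exists_isSorted (centroid (boxedPoints P R (max |p.1| |p.2| + 1)))
      (boxedPoints P R (max |p.1| |p.2| + 1))
    obtain ⟨m, k, hk⟩ := exists_isScan q
    exact ⟨_, _, _, hM, rfl, .inr ⟨h, n, m, q, k, hq, hk, rfl⟩⟩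

theorem validOn_union {P₁ P₂ R₁ R₂ : Finset Pt} {f : Ineq} :
    ValidOn (P₁ ∪ P₂) (R₁ ∪ R₂) f ↔ ValidOn P₁ R₁ f ∧ ValidOn P₂ R₂ f := by
  simp only [ValidOn, Finset.mem_union, or_imp, forall_and]
  tauto

/-- Both sides are the intersection of all valid half-planes. -/
theorem Describes.sol_eq {P R : Finset Pt} {E : Set Ineq} (h : Describes P R E)
    (hP : P.Nonempty) : sol E = convexHull ℝ (P : Set Pt) + cone R := by
  ext x
  rw [mem_convexHull_add_cone_iff hP]
  exact ⟨fun hx f hf => h.complete f hf x hx, fun hx e he => hx e (h.valid e he)⟩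

end PlanarHull

theorem mainTheorem1 (E₁ E₂ : Set PlanarHull.Ineq)
    (hL₁ : E₁ ⊆ PlanarHull.Lin) (hL₂ : E₂ ⊆ PlanarHull.Lin)
    (hne₁ : E₁.Nonempty) (hne₂ : E₂.Nonempty)
    (hfin₁ : E₁.Finite) (hfin₂ : E₂.Finite)
    (hsat₁ : PlanarHull.Satisfiable E₁) (hsat₂ : PlanarHull.Satisfiable E₂)
    (hnr₁ : PlanarHull.NonRedundant E₁) (hnr₂ : PlanarHull.NonRedundant E₂) :
    (∃ (P₁ R₁ P₂ R₂ : Finset PlanarHull.Pt) (Eres : Set PlanarHull.Ineq),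
      PlanarHull.IsHullRun E₁ E₂ P₁ R₁ P₂ R₂ Eres) ∧
    ∀ (P₁ R₁ P₂ R₂ : Finset PlanarHull.Pt) (Eres : Set PlanarHull.Ineq),
      PlanarHull.IsHullRun E₁ E₂ P₁ R₁ P₂ R₂ Eres →
        Eres.Finite ∧ Eres ⊆ PlanarHull.Lin ∧
        PlanarHull.NonRedundant Eres ∧
        PlanarHull.sol E₁ ∪ PlanarHull.sol E₂ ⊆ PlanarHull.sol Eres ∧
        (∀ E : Set PlanarHull.Ineq,
          PlanarHull.sol E₁ ∪ PlanarHull.sol E₂ ⊆ PlanarHull.sol E →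
            PlanarHull.sol Eres ⊆ PlanarHull.sol E) ∧
        PlanarHull.sol Eres =
          convexHull ℝ ((P₁ ∪ P₂ : Finset PlanarHull.Pt) : Set PlanarHull.Pt) +
            PlanarHull.cone (R₁ ∪ R₂) := by
  have hne : ¬ (E₁ = ∅ ∨ E₂ = ∅) := not_or.2 ⟨hne₁.ne_empty, hne₂.ne_empty⟩
  constructor
  · obtain ⟨P₁, R₁, h₁⟩ := PlanarHull.exists_isExtreme hL₁ hfin₁ hnr₁
    obtain ⟨P₂, R₂, h₂⟩ := PlanarHull.exists_isExtreme hL₂ hfin₂ hnr₂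
    obtain ⟨E, hE⟩ := PlanarHull.exists_isReconstruction
      ((h₁.points_nonempty hL₁ hne₁ hsat₁ hnr₁).mono Finset.subset_union_left : (P₁ ∪ P₂).Nonempty)
      (R₁ ∪ R₂)
    exact ⟨P₁, R₁, P₂, R₂, E, .inr ⟨hne, h₁, h₂, hE⟩⟩
  · rintro P₁ R₁ P₂ R₂ Eres (⟨h, -⟩ | ⟨-, h₁, h₂, hE⟩)
    · exact absurd h hne
    have hD := hE.describes fun r hr => (Finset.mem_union.1 hr).elim
      (fun h => h₁.ray_norm hL₁ h) (fun h => h₂.ray_norm hL₂ h)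
    have hv₁ := h₁.forall_holds_iff hL₁ hne₁ hsat₁ hnr₁
    have hv₂ := h₂.forall_holds_iff hL₂ hne₂ hsat₂ hnr₂
    refine ⟨hD.finite, hD.lin, hD.nonRedundant, ?_, fun E hsub x hx e he => ?_, hD.sol_eq
      ((h₁.points_nonempty hL₁ hne₁ hsat₁ hnr₁).mono Finset.subset_union_left)⟩
    · rintro x (hx | hx) e he
      · exact (hv₁ e).2 (PlanarHull.validOn_union.1 (hD.valid e he)).1 x hx
      · exact (hv₂ e).2 (PlanarHull.validOn_union.1 (hD.valid e he)).2 x hx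
    · exact hD.complete e (PlanarHull.validOn_union.2
        ⟨(hv₁ e).1 fun y hy => hsub (.inl hy) e he, (hv₂ e).1 fun y hy => hsub (.inr hy) e he⟩) x hx
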